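/- Let $\mathbb T=\mathbb R/\mathbb Z$, $\mathbb T^2=\mathbb R^2/\mathbb Z^2$ with coordinates $(q^1,q^2)$, let $g$ be a smooth Riemannian metric and $\sigma$ a smooth 2-form on $\mathbb T^2$ (oriented by $dq^1\wedge dq^2$). Let $\mathcal M=H^1(\mathbb T,\mathbb T^2)\times(0,\infty)$ be the Hilbert manifold of $H^1$-loops $\gamma=(x,T)$ with arbitrary period, $\gamma(t)=x(t/T)$. For $(a,b)\in\mathbb Z^2$ let $\mathcal M(a,b)\subset\mathcal M$ be the set of loops having a continuous lift $\tilde\gamma$ to $\mathbb R^2$ with $\tilde\gamma(T)=(a,b)+\tilde\gamma(0)$, and, for a fixed period $T>0$, let $\phi_{(a,b)}:\mathbb T^2\to\mathcal M(a,b)$, $\phi_{(a,b)}(q)=q+\gamma_{(a,b)}$, where $\gamma_{(a,b)}$ is the projection of $t\mapsto(ta/T,tb/T)$. Let $\bar\sigma=dq^1\wedge dq^2$ and define 1-forms on $\mathcal M$ by $$\tau_\gamma=\int_0^T\bar\sigma_{\gamma(t)}(\,\cdot\,,\dot\gamma(t))\,dt,\qquad \eta_k(x,T)=d\mathbb A_k(x,T)+\int_0^1\sigma_{x(s)}(\,\cdot\,,x'(s))\,ds,$$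 where $k>0$ and $\mathbb A_k(x,T)=T\int_0^1\big(\tfrac1{2T^2}|x'(s)|_g^2+k\big)\,ds$. Then: (0) $\tau$ and, for every $k>0$, $\eta_k$ are smooth closed 1-forms on $\mathcal M$, and $\phi_{(a,b)}$ is smooth. (i) For every $(a,b)\in\mathbb Z^2$ and every period $T>0$, $[\phi_{(a,b)}^*\tau]=-[\imath_{(a,b)}\bar\sigma]=[\,b\,dq^1-a\,dq^2\,]\in H^1(\mathbb T^2,\mathbb R)$, and the restricted class $[\tau]|_{\mathcal M(a,b)}$ is trivial if and only if $(a,b)=(0,0)$. (ii) For every $\gamma\in\mathcal M$ (in particular for every closed magnetic geodesic) there is a point $q\in\mathbb T^2\setminus\gamma(\mathbb R)$, and for every such $q$ the set $\mathcal V^\gamma$ of all loops in $\mathcal M$ with image in $\mathbb T^2\setminus\{q\}$ is open, contains all rotations $\psi\cdot\gamma^n$ of all iterates $\gamma^n$, $n\ge1$, and the class $[\tau]|_{\mathcal V^\gamma}$ is trivial. (iii) For every $k>0$, $(a,b)\in\mathbb Z^2$ and every period $T>0$, $[\phi_{(a,b)}^*\eta_k]=\big(\int_{\mathbb T^2}\sigma\big)\,[\,b\,dq^1-a\,dq^2\,]\in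 H^1(\mathbb T^2,\mathbb R)$, and the group of periods $[\eta_k]\big(H_1(\mathcal M(a,b),\mathbb Z)\big)$ is a discrete subgroup of $\mathbb R$. -/

import Mathlib

open scoped Manifold ContDiff Topology
open MeasureTheory Set

namespace MagneticTorus

noncomputable section

/-! ### Manifolds whose charts are translations -/

section Charts

variable {E X : Type*} [NormedAddCommGroup E] [NormedSpace ℝ E]
  [AddCommGroup X] [TopologicalSpace X] [IsTopologicalAddGroup X]

theorem isLocalHomeomorph_translate (p : E →+ X) (hp : IsLocalHomeomorph p) (x : X) :
    IsLocalHomeomorph (fun e : E => x + p e) :=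
  (Homeomorph.addLeft x).isLocalHomeomorph.comp hp

/-- A restriction of `e ↦ x + p e` to an open neighbourhood of `0` on which it is a homeomorphism
onto an open subset of `X`. -/
def translateParam (p : E →+ X) (hp : IsLocalHomeomorph p) (x : X) : OpenPartialHomeomorph E X :=
  (isLocalHomeomorph_translate p hp x 0).choose

theorem zero_mem_translateParam (p : E →+ X) (hp : IsLocalHomeomorph p) (x : X) :
    (0 : E) ∈ (translateParam p hp x).source :=
  (isLocalHomeomorph_translate p hp x 0).choose_spec.1

theorem translateParam_apply (p : E →+ X) (hp : IsLocalHomeomorph p) (x : X) (e : E) :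
    translateParam p hp x e = x + p e :=
  (congrFun (isLocalHomeomorph_translate p hp x 0).choose_spec.2 e).symm

/-- The atlas given by a homomorphism `p : E → X` that is a local homeomorphism: the chart at `x`
is the local inverse of `e ↦ x + p e`. -/
@[reducible]
def translationCharts (p : E →+ X) (hp : IsLocalHomeomorph p) : ChartedSpace E X where
  atlas := range fun x => (translateParam p hp x).symm
  chartAt x := (translateParam p hp x).symm
  mem_chart_source x := by
    have h := (translateParam p hp x).map_source (zero_mem_translateParam p hp x)
    simpa [translateParam_apply] using h
  chart_mem_atlas x := ⟨x, rfl⟩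

/-- The coordinate changes of this atlas are locally translations, so the atlas is smooth. -/
theorem isManifold_translationCharts (p : E →+ X) (hp : IsLocalHomeomorph p) :
    @IsManifold ℝ _ E _ _ E _ 𝓘(ℝ, E) ∞ X _ (translationCharts p hp) := by
  let _ := translationCharts p hp
  refine isManifold_of_contDiffOn 𝓘(ℝ, E) ∞ X ?_
  rintro _ _ ⟨x, rfl⟩ ⟨y, rfl⟩
  simp only [modelWithCornersSelf_coe, modelWithCornersSelf_coe_symm, Function.comp_id,
    Function.id_comp, preimage_id, range_id, inter_univ, OpenPartialHomeomorph.symm_symm]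
  intro e he
  apply ContDiffAt.contDiffWithinAt
  set P := translateParam p hp x
  set Q := translateParam p hp y
  have hs : e ∈ P.source ∧ P e ∈ Q.target := by
    simpa [OpenPartialHomeomorph.trans_source] using he
  set e' := Q.symm (P e)
  have he' : e' ∈ Q.source := Q.map_target hs.2
  have hQ : Q e' = P e := Q.right_inv hs.2
  have hev : ∀ᶠ z in 𝓝 e, (P.trans Q.symm) z = e' + (z - e) := by
    have hc : Filter.Tendsto (fun z : E => e' + (z - e)) (𝓝 e) (𝓝 e') := by
      have : Continuous (fun z : E => e' + (z - e)) := by fun_prop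
      simpa using this.tendsto e
    filter_upwards [hc.eventually (Q.open_source.mem_nhds he')] with z hz
    have h1 : Q (e' + (z - e)) = P z := by
      have hQ' : y + p e' = x + p e := by
        simpa [P, Q, translateParam_apply] using hQ
      simp only [P, Q, translateParam_apply, map_add, map_sub]
      rw [← add_assoc, hQ']; abel
    change Q.symm (P z) = _
    rw [← h1, Q.left_inv hz]
  have : ContDiffAt ℝ ∞ (fun z : E => e' + (z - e)) e := by fun_prop
  exact this.congr_of_eventuallyEq hev

end Charts

/-! ### The torus -/

abbrev Plane : Type := ℝ × ℝ

abbrev Torus : Type := UnitAddCircle × UnitAddCircle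

/-- The projection `ℝ² → 𝕋² = ℝ²/ℤ²`. -/
def proj : Plane →+ Torus where
  toFun v := ((v.1 : UnitAddCircle), (v.2 : UnitAddCircle))
  map_zero' := by simp
  map_add' v w := by simp

theorem isLocalHomeomorph_coe_circle :
    IsLocalHomeomorph ((↑) : ℝ → UnitAddCircle) :=
  AddCircle.isLocalHomeomorph_coe (1 : ℝ)

theorem isLocalHomeomorph_prodMap {A B C D : Type*} [TopologicalSpace A] [TopologicalSpace B]
    [TopologicalSpace C] [TopologicalSpace D] {f : A → B} {h : C → D}
    (hf : IsLocalHomeomorph f) (hh : IsLocalHomeomorph h) :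
    IsLocalHomeomorph (fun z : A × C => (f z.1, h z.2)) := by
  rintro ⟨a, c⟩
  obtain ⟨e, ha, rfl⟩ := hf a
  obtain ⟨e', hc, rfl⟩ := hh c
  exact ⟨e.prod e', ⟨ha, hc⟩, rfl⟩

theorem isLocalHomeomorph_proj : IsLocalHomeomorph proj :=
  isLocalHomeomorph_prodMap isLocalHomeomorph_coe_circle isLocalHomeomorph_coe_circle

instance : ChartedSpace Plane Torus := translationCharts proj isLocalHomeomorph_proj

instance : IsManifold 𝓘(ℝ, Plane) ∞ Torus := isManifold_translationCharts _ _

/-! ### Differential 1-forms, first de Rham cohomology, periods -/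

section Forms

variable (E X : Type*) [NormedAddCommGroup E] [NormedSpace ℝ E]

/-- 1-forms on a manifold with translation charts: the tangent bundle is trivialised by the charts,
so that every tangent space is `E`, compatibly with Mathlib's `TangentSpace`. -/
abbrev OneForm : Type _ := X → E →L[ℝ] ℝ

instance : AddCommGroup (OneForm E X) := Pi.addCommGroup

variable {E X} [TopologicalSpace X] [ChartedSpace E X]

/-- The exterior derivative of a function. -/
def extDer (f : X → ℝ) : OneForm E X := fun x => mfderiv 𝓘(ℝ, E) 𝓘(ℝ, ℝ) f x

/-- The derivative `v ↦ D_v α` of a 1-form in a translation chart. -/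
def formDer (α : OneForm E X) (x : X) : E →L[ℝ] E →L[ℝ] ℝ :=
  mfderiv 𝓘(ℝ, E) 𝓘(ℝ, E →L[ℝ] ℝ) α x

/-- The 1-forms that are smooth and closed on the open set `U`: the derivative
`(v, w) ↦ D_v α (w)` in a translation chart is symmetric, that is `dα = 0`. -/
def closedForms (U : Set X) : Submodule ℝ (OneForm E X) where
  carrier := {α | ∀ x ∈ U, ContMDiffAt 𝓘(ℝ, E) 𝓘(ℝ, E →L[ℝ] ℝ) ∞ α x ∧
    ∀ v w : E, formDer α x v w = formDer α x w v}
  zero_mem' := by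
    intro x _
    refine ⟨contMDiffAt_const, fun v w => ?_⟩
    have : formDer (0 : OneForm E X) x = 0 := mfderiv_const (c := (0 : E →L[ℝ] ℝ))
    rw [this]; rfl
  add_mem' := by
    intro α β hα hβ x hx
    refine ⟨(hα x hx).1.add (hβ x hx).1, fun v w => ?_⟩
    have : formDer (α + β) x = formDer α x + formDer β x :=
      mfderiv_add ((hα x hx).1.mdifferentiableAt (by simp))
        ((hβ x hx).1.mdifferentiableAt (by simp))
    rw [this]
    exact congrArg₂ (· + ·) ((hα x hx).2 v w) ((hβ x hx).2 v w)
  smul_mem' := by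
    intro c α hα x hx
    refine ⟨(contDiff_const_smul c).contMDiff.contMDiffAt.comp x (hα x hx).1, fun v w => ?_⟩
    have : formDer (c • α) x = c • formDer α x :=
      const_smul_mfderiv ((hα x hx).1.mdifferentiableAt (by simp)) c
    rw [this]
    exact congrArg (c • ·) ((hα x hx).2 v w)

/-- The 1-forms that are the differential of a smooth function on the open set `U`. -/
def exactForms (U : Set X) : Submodule ℝ (OneForm E X) where
  carrier := {α | ∃ f : X → ℝ, ∀ x ∈ U,
    ContMDiffAt 𝓘(ℝ, E) 𝓘(ℝ, ℝ) ∞ f x ∧ α x = extDer f x}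
  zero_mem' := by
    refine ⟨0, fun x _ => ⟨contMDiffAt_const, ?_⟩⟩
    exact (mfderiv_const (c := (0 : ℝ))).symm
  add_mem' := by
    rintro α β ⟨f, hf⟩ ⟨h, hh⟩
    refine ⟨f + h, fun x hx => ⟨(hf x hx).1.add (hh x hx).1, ?_⟩⟩
    have := mfderiv_add ((hf x hx).1.mdifferentiableAt (by simp))
      ((hh x hx).1.mdifferentiableAt (by simp))
    rw [Pi.add_apply, (hf x hx).2, (hh x hx).2]
    exact this.symm
  smul_mem' := by
    rintro c α ⟨f, hf⟩
    refine ⟨c • f, fun x hx => ⟨(contDiff_const_smul c).contMDiff.contMDiffAt.comp x (hf x hx).1, ?_⟩⟩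
    have := const_smul_mfderiv ((hf x hx).1.mdifferentiableAt (by simp)) c
    rw [Pi.smul_apply, (hf x hx).2]
    exact this.symm

/-- `H¹(U, ℝ)`: closed 1-forms on the open set `U` modulo those that are exact on `U`. (Forms that
agree on `U` are identified, because a form vanishing on `U` is exact on `U`.) -/
abbrev DeRhamH1 (E : Type*) {X : Type*} [NormedAddCommGroup E] [NormedSpace ℝ E]
    [TopologicalSpace X] [ChartedSpace E X] (U : Set X) : Type _ :=
  ↥(closedForms (E := E) U) ⧸ (exactForms (E := E) U).submoduleOf (closedForms U)

/-- The cohomology class on `U` of a 1-form that is closed on `U`. -/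
def cohClass (U : Set X) (α : OneForm E X) (hα : α ∈ closedForms U) : DeRhamH1 E U :=
  Submodule.Quotient.mk ⟨α, hα⟩

/-- The pull-back of a 1-form by a map of manifolds. -/
def pullback {F Y : Type*} [NormedAddCommGroup F] [NormedSpace ℝ F] [TopologicalSpace Y]
    [ChartedSpace F Y] (φ : X → Y) (α : OneForm F Y) : OneForm E X :=
  fun x => (α (φ x)).comp (mfderiv 𝓘(ℝ, E) 𝓘(ℝ, F) φ x : E →L[ℝ] F)

/-- The integral of a 1-form along a path parametrised by `[0,1]`. -/
def pathIntegral (α : OneForm E X) (c : ℝ → X) : ℝ :=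
  ∫ t in (0 : ℝ)..1, α (c t) (mfderivWithin 𝓘(ℝ, ℝ) 𝓘(ℝ, E) c (Icc 0 1) t (1 : ℝ) : E)

/-- The boundary of a singular 1-chain with integer coefficients; a 1-simplex is given by a map
on `ℝ` of which only the restriction to `[0,1]` matters. -/
def boundary (X : Type*) : ((ℝ → X) →₀ ℤ) →+ (X →₀ ℤ) :=
  Finsupp.liftAddHom fun c =>
    (Finsupp.singleAddHom (c 1) : ℤ →+ (X →₀ ℤ)) - Finsupp.singleAddHom (c 0)

/-- The group of smooth singular 1-cycles in `U`, with integer coefficients. -/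
def smoothCycles (E : Type*) {X : Type*} [NormedAddCommGroup E] [NormedSpace ℝ E]
    [TopologicalSpace X] [ChartedSpace E X] (U : Set X) : AddSubgroup ((ℝ → X) →₀ ℤ) where
  carrier := {z | (∀ c ∈ z.support, ContMDiffOn 𝓘(ℝ, ℝ) 𝓘(ℝ, E) ∞ c (Icc 0 1) ∧
    MapsTo c (Icc 0 1) U) ∧ boundary X z = 0}
  zero_mem' := by simp
  add_mem' := by
    classical
    rintro z w ⟨hz, hz'⟩ ⟨hw, hw'⟩
    refine ⟨fun c hc => ?_, by rw [map_add, hz', hw', add_zero]⟩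
    rcases Finset.mem_union.1 (Finsupp.support_add hc) with h | h
    exacts [hz c h, hw c h]
  neg_mem' := by
    rintro z ⟨hz, hz'⟩
    refine ⟨fun c hc => hz c (by simpa using hc), by rw [map_neg, hz', neg_zero]⟩

/-- Integration of a 1-form over singular 1-chains. -/
def chainIntegral (α : OneForm E X) : ((ℝ → X) →₀ ℤ) →+ ℝ :=
  Finsupp.liftAddHom fun c => (AddMonoidHom.mulRight (pathIntegral α c)).comp (Int.castAddHom ℝ)

/-- The group of periods of `α` over `U`: the image of `H₁(U, ℤ)`, represented by smooth singular
cycles, under integration of `α`. -/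
def periods (α : OneForm E X) (U : Set X) : AddSubgroup ℝ :=
  (smoothCycles E U).map (chainIntegral α)

end Forms

/-! ### `H¹` loops -/

/-- `L²(𝕋, ℝ²)`. -/
abbrev L2 : Type := Lp Plane 2 (volume : Measure UnitAddCircle)

theorem integrable_L2 (u : L2) : Integrable (u : UnitAddCircle → Plane) volume :=
  (Lp.memLp u).integrable (by norm_num)

theorem intervalIntegrable_of_integrable {u : UnitAddCircle → Plane} (hu : Integrable u volume) :
    IntervalIntegrable (fun r : ℝ => u r) volume 0 1 := by
  have h := (AddCircle.measurePreserving_mk (1 : ℝ) 0).integrable_comp_of_integrable hu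
  rw [intervalIntegrable_iff_integrableOn_Ioc_of_le zero_le_one]
  simpa [IntegrableOn, Function.comp_def] using h

/-- The primitive `s ↦ ∫₀ˢ u` of `u ∈ L²(𝕋, ℝ²)`. -/
def prim (u : L2) (s : ℝ) : Plane := ∫ r in (0 : ℝ)..s, u (r : UnitAddCircle)

theorem intervalIntegrable_L2 (u : L2) {s : ℝ} (hs : s ∈ Icc (0 : ℝ) 1) :
    IntervalIntegrable (fun r : ℝ => u (r : UnitAddCircle)) volume 0 s :=
  (intervalIntegrable_of_integrable (integrable_L2 u)).mono_set (by
    rw [uIcc_of_le hs.1, uIcc_of_le zero_le_one]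
    exact Icc_subset_Icc le_rfl hs.2)

theorem integral_congr_L2 {u v : UnitAddCircle → Plane} (h : u =ᵐ[volume] v) {s : ℝ}
    (hs : s ∈ Icc (0 : ℝ) 1) :
    ∫ r in (0 : ℝ)..s, u (r : UnitAddCircle) = ∫ r in (0 : ℝ)..s, v (r : UnitAddCircle) := by
  have h' := (AddCircle.measurePreserving_mk (1 : ℝ) 0).quasiMeasurePreserving.ae_eq_comp h
  rw [intervalIntegral.integral_of_le hs.1, intervalIntegral.integral_of_le hs.1]
  refine integral_congr_ae ?_
  refine ae_restrict_of_ae_restrict_of_subset (t := Ioc (0 : ℝ) (0 + 1)) ?_ h'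
  exact Ioc_subset_Ioc le_rfl (by simpa using hs.2)

theorem prim_zero {s : ℝ} (hs : s ∈ Icc (0 : ℝ) 1) : prim 0 s = 0 := by
  unfold prim
  rw [integral_congr_L2 (Lp.coeFn_zero Plane 2 (volume : Measure UnitAddCircle)) hs]
  simp

theorem prim_add (u v : L2) {s : ℝ} (hs : s ∈ Icc (0 : ℝ) 1) :
    prim (u + v) s = prim u s + prim v s := by
  unfold prim
  rw [integral_congr_L2 (Lp.coeFn_add u v) hs]
  exact intervalIntegral.integral_add (intervalIntegrable_L2 u hs) (intervalIntegrable_L2 v hs)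

theorem prim_smul (c : ℝ) (u : L2) {s : ℝ} (hs : s ∈ Icc (0 : ℝ) 1) :
    prim (c • u) s = c • prim u s := by
  unfold prim
  rw [integral_congr_L2 (Lp.coeFn_smul c u) hs]
  exact intervalIntegral.integral_smul c _

theorem prim_neg (u : L2) {s : ℝ} (hs : s ∈ Icc (0 : ℝ) 1) :
    prim (-u) s = -prim u s := by
  have := prim_smul (-1) u hs
  simpa using this

/-- `H¹(𝕋, ℝ²)`: pairs `(ξ, ξ')` of a continuous function and a square integrable one such that
`ξ(s) = ξ(0) + ∫₀ˢ ξ'`, that is, `ξ` is absolutely continuous with derivative `ξ' ∈ L²`. The norm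
`max (‖ξ‖_∞, ‖ξ'‖_{L²})` is equivalent to the usual Hilbert norm of `H¹`. -/
def H1 : Submodule ℝ (C(UnitAddCircle, Plane) × L2) where
  carrier := {ξ | ∀ s ∈ Icc (0 : ℝ) 1, ξ.1 (s : UnitAddCircle) = ξ.1 0 + prim ξ.2 s}
  zero_mem' := by
    intro s hs
    simp [prim_zero hs]
  add_mem' := by
    intro ξ ζ hξ hζ s hs
    simp only [Prod.fst_add, Prod.snd_add, ContinuousMap.add_apply, prim_add _ _ hs, hξ s hs,
      hζ s hs]
    abel
  smul_mem' := by
    intro c ξ hξ s hs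
    simp only [Prod.smul_fst, Prod.smul_snd, ContinuousMap.smul_apply, prim_smul _ _ hs, hξ s hs,
      smul_add]

/-- `H¹(𝕋, 𝕋²)`: pairs `(x, x')` of a continuous loop in the torus and its derivative
`x' ∈ L²(𝕋, ℝ²)`, in the sense that `x(s) = x(0) + ∫₀ˢ x'` modulo `ℤ²`. It carries the `H¹`
topology: uniform convergence of `x` and `L²` convergence of `x'`. -/
def H1Loop : AddSubgroup (C(UnitAddCircle, Torus) × L2) where
  carrier := {x | ∀ s ∈ Icc (0 : ℝ) 1, x.1 (s : UnitAddCircle) = x.1 0 + proj (prim x.2 s)}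
  zero_mem' := by
    intro s hs
    simp [prim_zero hs]
  add_mem' := by
    intro x y hx hy s hs
    simp only [Prod.fst_add, Prod.snd_add, ContinuousMap.add_apply, prim_add _ _ hs, hx s hs,
      hy s hs, map_add]
    abel
  neg_mem' := by
    intro x hx s hs
    simp only [Prod.fst_neg, Prod.snd_neg, ContinuousMap.neg_apply, prim_neg _ hs, hx s hs,
      map_neg]
    abel

theorem continuous_proj : Continuous proj := isLocalHomeomorph_proj.continuous

/-- The map `ξ ↦ π ∘ ξ` from `H¹(𝕋, ℝ²)` to `H¹(𝕋, 𝕋²)`. -/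
def loopExp : H1 →+ H1Loop where
  toFun ξ := ⟨(⟨fun s => proj (ξ.1.1 s), continuous_proj.comp ξ.1.1.continuous⟩, ξ.1.2), by
    intro s hs
    have := congrArg proj (ξ.2 s hs)
    rwa [map_add] at this⟩
  map_zero' := by
    apply Subtype.ext
    refine Prod.ext ?_ rfl
    ext1 s
    exact map_zero proj
  map_add' ξ ζ := by
    apply Subtype.ext
    refine Prod.ext ?_ rfl
    ext1 s
    exact map_add proj _ _

/-- A small circle element has a unique small real representative, depending continuously on it. -/
theorem exists_circle_section : ∃ r : UnitAddCircle → ℝ,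
    ContinuousOn r (Metric.ball 0 (1 / 2)) ∧
    ∀ z : UnitAddCircle, ‖z‖ < 1 / 2 → ((r z : ℝ) : UnitAddCircle) = z ∧ |r z| = ‖z‖ := by
  let e := AddCircle.openPartialHomeomorphCoe (1 : ℝ) (-(1 / 2) : ℝ)
  have ht : ∀ z : UnitAddCircle, ‖z‖ < 1 / 2 → z ∈ e.target := by
    intro z hz hz'
    have h1 : z = ((-(1 / 2) : ℝ) : UnitAddCircle) := hz'
    have h2 : ‖((-(1 / 2) : ℝ) : UnitAddCircle)‖ = |(-(1 / 2) : ℝ)| :=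
      (AddCircle.norm_coe_eq_abs_iff (1 : ℝ) one_ne_zero).2 (by norm_num)
    rw [h1, h2] at hz
    norm_num at hz
  refine ⟨e.symm, e.continuousOn_symm.mono fun z hz => ht z (by simpa using hz), fun z hz => ?_⟩
  have h1 : ((e.symm z : ℝ) : UnitAddCircle) = z := e.right_inv (ht z hz)
  have h2 : e.symm z ∈ Ioo (-(1 / 2) : ℝ) (-(1 / 2) + 1) := e.map_target (ht z hz)
  refine ⟨h1, ?_⟩
  have h3 : ‖((e.symm z : ℝ) : UnitAddCircle)‖ = |e.symm z| := by
    refine (AddCircle.norm_coe_eq_abs_iff (1 : ℝ) one_ne_zero).2 ?_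
    rw [abs_one, abs_le]
    constructor <;> linarith [h2.1, h2.2]
  rw [← h3, h1]

theorem continuousOn_prim (u : L2) : ContinuousOn (prim u) (Icc 0 1) := by
  have h := intervalIntegral.continuousOn_primitive_interval'
    (intervalIntegrable_of_integrable (integrable_L2 u)) left_mem_uIcc
  rwa [uIcc_of_le zero_le_one] at h

theorem eqOn_of_coe_eqOn {f h : ℝ → ℝ} (hf : ContinuousOn f (Icc 0 1))
    (hh : ContinuousOn h (Icc 0 1)) (h0 : f 0 = h 0)
    (hc : ∀ s ∈ Icc (0 : ℝ) 1, ((f s : ℝ) : UnitAddCircle) = (h s : UnitAddCircle)) :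
    EqOn f h (Icc 0 1) :=
  (AddCircle.isCoveringMap_coe (1 : ℝ)).eqOn_of_comp_eqOn isPreconnected_Icc hf hh hc
    (left_mem_Icc.2 zero_le_one) h0

/-- Loops near the constant loop `0` lift to small elements of `H¹(𝕋, ℝ²)`. -/
theorem exists_lift_of_norm_lt (y : H1Loop) (hy : ‖y‖ < 1 / 2) :
    ∃ ξ : H1, loopExp ξ = y ∧ ‖ξ‖ ≤ ‖y‖ := by
  obtain ⟨r, hr, hr'⟩ := exists_circle_section
  have hn : ∀ s, ‖y.1.1 s‖ ≤ ‖y.1.1‖ := y.1.1.norm_coe_le_norm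
  have hy1 : ‖y.1.1‖ < 1 / 2 := (norm_fst_le y.1).trans_lt hy
  have h1 : ∀ s, ‖(y.1.1 s).1‖ < 1 / 2 := fun s =>
    ((norm_fst_le (y.1.1 s)).trans (hn s)).trans_lt hy1
  have h2 : ∀ s, ‖(y.1.1 s).2‖ < 1 / 2 := fun s =>
    ((norm_snd_le (y.1.1 s)).trans (hn s)).trans_lt hy1
  have c1 : Continuous fun s => r (y.1.1 s).1 :=
    hr.comp_continuous (continuous_fst.comp y.1.1.continuous) fun s => by simpa using h1 s
  have c2 : Continuous fun s => r (y.1.1 s).2 :=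
    hr.comp_continuous (continuous_snd.comp y.1.1.continuous) fun s => by simpa using h2 s
  let f : C(UnitAddCircle, Plane) := ⟨fun s => (r (y.1.1 s).1, r (y.1.1 s).2), c1.prodMk c2⟩
  have hf : ∀ s, proj (f s) = y.1.1 s := fun s =>
    Prod.ext (hr' _ (h1 s)).1 (hr' _ (h2 s)).1
  have hcoe : Continuous fun s : ℝ => (s : UnitAddCircle) := isLocalHomeomorph_coe_circle.continuous
  have hmem : (f, y.1.2) ∈ H1 := by
    have key : ∀ s ∈ Icc (0 : ℝ) 1, proj (f (s : UnitAddCircle)) = proj (f 0 + prim y.1.2 s) := by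
      intro s hs
      rw [map_add, hf, hf]
      exact y.2 s hs
    have p0 : prim y.1.2 0 = 0 := intervalIntegral.integral_same
    intro s hs
    refine Prod.ext ?_ ?_
    · refine eqOn_of_coe_eqOn (f := fun s => (f (s : UnitAddCircle)).1)
        (h := fun s => (f 0 + prim y.1.2 s).1) ?_ ?_ ?_ ?_ hs
      · exact (continuous_fst.comp (f.continuous.comp hcoe)).continuousOn
      · exact continuous_fst.comp_continuousOn (continuousOn_const.add (continuousOn_prim _))
      · simp [p0]
      · exact fun s hs => congrArg Prod.fst (key s hs)
    · refine eqOn_of_coe_eqOn (f := fun s => (f (s : UnitAddCircle)).2)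
        (h := fun s => (f 0 + prim y.1.2 s).2) ?_ ?_ ?_ ?_ hs
      · exact (continuous_snd.comp (f.continuous.comp hcoe)).continuousOn
      · exact continuous_snd.comp_continuousOn (continuousOn_const.add (continuousOn_prim _))
      · simp [p0]
      · exact fun s hs => congrArg Prod.snd (key s hs)
  refine ⟨⟨(f, y.1.2), hmem⟩, ?_, ?_⟩
  · apply Subtype.ext
    refine Prod.ext ?_ rfl
    ext1 s
    exact hf s
  · change max ‖f‖ ‖y.1.2‖ ≤ max ‖y.1.1‖ ‖y.1.2‖
    refine max_le_max ((ContinuousMap.norm_le _ (norm_nonneg _)).2 fun s => ?_) le_rfl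
    refine le_trans ?_ (hn s)
    refine max_le_max (le_of_eq ?_) (le_of_eq ?_)
    · exact (hr' _ (h1 s)).2
    · exact (hr' _ (h2 s)).2

theorem continuous_loopExp : Continuous loopExp := by
  refine Continuous.subtype_mk (Continuous.prodMk ?_ ?_) _
  · exact (ContinuousMap.continuous_postcomp (⟨proj, continuous_proj⟩ : C(Plane, Torus))).comp
      (continuous_fst.comp continuous_subtype_val)
  · exact continuous_snd.comp continuous_subtype_val

theorem eq_zero_of_loopExp_eq_zero {ξ : H1} (h : loopExp ξ = 0) (hξ : ‖ξ‖ < 1 / 2) : ξ = 0 := by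
  have hz : ∀ t : ℝ, |t| < 1 / 2 → (t : UnitAddCircle) = 0 → t = 0 := by
    intro t ht h0
    have := (AddCircle.norm_coe_eq_abs_iff (1 : ℝ) (x := t) one_ne_zero).2 (by
      rw [abs_one]; exact ht.le)
    rw [h0, norm_zero] at this
    exact abs_eq_zero.1 this.symm
  have h' : ξ.1.1 = 0 ∧ ξ.1.2 = 0 := by
    refine ⟨?_, congrArg (fun y : H1Loop => y.1.2) h⟩
    ext1 s
    have hs : proj (ξ.1.1 s) = 0 := congrArg (fun y : H1Loop => y.1.1 s) h
    have hn : ‖ξ.1.1 s‖ < 1 / 2 :=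
      ((ξ.1.1.norm_coe_le_norm s).trans (norm_fst_le ξ.1)).trans_lt hξ
    exact Prod.ext (hz _ ((norm_fst_le _).trans_lt hn) (congrArg Prod.fst hs))
      (hz _ ((norm_snd_le _).trans_lt hn) (congrArg Prod.snd hs))
  exact Subtype.ext (Prod.ext h'.1 h'.2)

theorem isLocalHomeomorph_loopExp : IsLocalHomeomorph loopExp := by
  have hopen : IsOpenMap loopExp := by
    refine IsOpenMap.of_nhds_le fun ξ => ?_
    intro V hV
    obtain ⟨ε, hε, hεV⟩ := Metric.mem_nhds_iff.1 (Filter.mem_map.1 hV)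
    refine Metric.mem_nhds_iff.2 ⟨min ε (1 / 2), by positivity, fun y hy => ?_⟩
    rw [Metric.mem_ball, dist_eq_norm] at hy
    obtain ⟨ζ, hζ, hζn⟩ := exists_lift_of_norm_lt (y - loopExp ξ) (hy.trans_le (min_le_right _ _))
    have hm : ξ + ζ ∈ Metric.ball ξ ε := by
      rw [Metric.mem_ball, dist_eq_norm, add_sub_cancel_left]
      exact (hζn.trans_lt hy).trans_le (min_le_left _ _)
    have := hεV hm
    rwa [mem_preimage, map_add, hζ, add_sub_cancel] at this
  refine isLocalHomeomorph_iff_isOpenEmbedding_restrict.2 fun ξ => ?_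
  refine ⟨Metric.ball ξ (1 / 4), Metric.ball_mem_nhds _ (by norm_num), ?_⟩
  refine Topology.IsOpenEmbedding.of_continuous_injective_isOpenMap
    (continuous_loopExp.comp continuous_subtype_val) ?_
    (hopen.comp Metric.isOpen_ball.isOpenMap_subtype_val)
  rintro ⟨a, ha⟩ ⟨b, hb⟩ hab
  have hab' : loopExp a = loopExp b := hab
  have h0 : loopExp (a - b) = 0 := by rw [map_sub, hab', sub_self]
  have hlt : ‖a - b‖ < 1 / 2 := by
    refine lt_of_eq_of_lt (dist_eq_norm a b).symm ?_
    calc dist a b ≤ dist a ξ + dist b ξ := dist_triangle_right _ _ _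
      _ < 1 / 4 + 1 / 4 := add_lt_add ha hb
      _ = 1 / 2 := by norm_num
  exact Subtype.ext (sub_eq_zero.1 (eq_zero_of_loopExp_eq_zero h0 hlt))

/-! ### The free loop space with arbitrary period -/

/-- `H¹(𝕋, 𝕋²) × ℝ`; the free loop space is its open subset where the period is positive. -/
abbrev Loop : Type := H1Loop × ℝ

/-- The tangent space `H¹(𝕋, ℝ²) × ℝ` at every point. -/
abbrev LoopVec : Type := H1 × ℝ

/-- The exponential map `(ξ, t) ↦ (π ∘ ξ, t)`; the chart at `(x, T)` is the local inverse of
`(ξ, t) ↦ (x + π ∘ ξ, T + t)`, as for the exponential map of the flat torus. -/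
def freeExp : LoopVec →+ Loop := loopExp.prodMap (AddMonoidHom.id ℝ)

theorem isLocalHomeomorph_freeExp : IsLocalHomeomorph freeExp :=
  isLocalHomeomorph_prodMap isLocalHomeomorph_loopExp (Homeomorph.refl ℝ).isLocalHomeomorph

instance : ChartedSpace LoopVec Loop := translationCharts freeExp isLocalHomeomorph_freeExp

instance : IsManifold 𝓘(ℝ, LoopVec) ∞ Loop := isManifold_translationCharts _ _

/-- The loop `x : 𝕋 → 𝕋²` of `γ = (x, T)`. -/
def Loop.pt (γ : Loop) (s : UnitAddCircle) : Torus := γ.1.1.1 s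

/-- The derivative `x'` of the loop of `γ = (x, T)`. -/
def Loop.vel (γ : Loop) (s : UnitAddCircle) : Plane := γ.1.1.2 s

/-- The value at `s` of the vector field along the loop given by a tangent vector. -/
def LoopVec.field (ζ : LoopVec) (s : UnitAddCircle) : Plane := ζ.1.1.1 s

/-- The periodic curve `γ(t) = x(t / T)`. -/
def Loop.curve (γ : Loop) (t : ℝ) : Torus := Loop.pt γ ((t / γ.2 : ℝ) : UnitAddCircle)

/-- The free loop space `ℳ = H¹(𝕋, 𝕋²) × (0, ∞)`. -/
def freeLoops : Set Loop := {γ | 0 < γ.2}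

/-- The component `ℳ(a, b)`: loops with a lift `c` to `ℝ²` such that `c(T) = (a, b) + c(0)`. -/
def component (a b : ℤ) : Set Loop :=
  {γ | γ ∈ freeLoops ∧ ∃ c : ℝ → Plane, Continuous c ∧ (∀ t, proj (c t) = Loop.curve γ t) ∧
    c γ.2 = ((a : ℝ), (b : ℝ)) + c 0}

/-- The loops whose image does not contain `q`. -/
def avoiding (q : Torus) : Set Loop := {γ | γ ∈ freeLoops ∧ ∀ t, Loop.curve γ t ≠ q}

/-- `β = ψ · γⁿ`: the loop `γ = (x, T)` iterated `n` times and rotated by `ψ`, that is, the loop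
`s ↦ x(n (ψ + s))` with period `n T`. -/
def IsRotatedIterate (γ : Loop) (n : ℕ) (ψ : UnitAddCircle) (β : Loop) : Prop :=
  β.2 = n * γ.2 ∧ ∀ s, Loop.pt β s = Loop.pt γ (n • (ψ + s))

theorem straightLoop_mem (a b : ℤ) (q : Torus) :
    ((⟨fun s => q + (a • s, b • s), by fun_prop⟩ : C(UnitAddCircle, Torus)),
      (Lp.const 2 (volume : Measure UnitAddCircle) ((a : ℝ), (b : ℝ)) : L2)) ∈ H1Loop := by
  intro s hs
  have h : prim (Lp.const 2 (volume : Measure UnitAddCircle) ((a : ℝ), (b : ℝ))) s =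
      s • ((a : ℝ), (b : ℝ)) := by
    unfold prim
    rw [integral_congr_L2 (Lp.coeFn_const 2 (volume : Measure UnitAddCircle) ((a : ℝ), (b : ℝ))) hs]
    simp
  simp only [ContinuousMap.coe_mk, h, smul_zero, Prod.mk_zero_zero, add_zero]
  congr 1
  refine Prod.ext ?_ ?_
  · change a • (s : UnitAddCircle) = ((s • (a : ℝ) : ℝ) : UnitAddCircle)
    rw [← AddCircle.coe_zsmul, zsmul_eq_mul, smul_eq_mul, mul_comm]
  · change b • (s : UnitAddCircle) = ((s • (b : ℝ) : ℝ) : UnitAddCircle)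
    rw [← AddCircle.coe_zsmul, zsmul_eq_mul, smul_eq_mul, mul_comm]

/-- The map `φ_{(a,b)}(q) = q + γ_{(a,b)}`, where `γ_{(a,b)}` is the projection of
`t ↦ (t a / T, t b / T)`, with period `T`. -/
def straight (a b : ℤ) (T : ℝ) (q : Torus) : Loop := (⟨_, straightLoop_mem a b q⟩, T)

/-! ### Metric, 2-forms and the action 1-form -/

/-- A smooth Riemannian metric on the torus, in the trivialisation `T𝕋² = 𝕋² × ℝ²`. -/
structure TorusMetric where
  toFun : Torus → Plane →L[ℝ] Plane →L[ℝ] ℝ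
  smooth : ContMDiff 𝓘(ℝ, Plane) 𝓘(ℝ, Plane →L[ℝ] Plane →L[ℝ] ℝ) ∞ toFun
  symm : ∀ q v w, toFun q v w = toFun q w v
  pos : ∀ q v, v ≠ 0 → 0 < toFun q v v

/-- A smooth differential 2-form on the torus, in the trivialisation `T𝕋² = 𝕋² × ℝ²`. -/
structure TwoForm where
  toFun : Torus → Plane →L[ℝ] Plane →L[ℝ] ℝ
  smooth : ContMDiff 𝓘(ℝ, Plane) 𝓘(ℝ, Plane →L[ℝ] Plane →L[ℝ] ℝ) ∞ toFun
  alt : ∀ q v, toFun q v v = 0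

/-- `∫_{𝕋²} σ`, the torus being oriented by `dq¹ ∧ dq²`. -/
def TwoForm.integral (σ : TwoForm) : ℝ := ∫ q : Torus, σ.toFun q (1, 0) (0, 1)

/-- The 1-form `dq¹`. -/
def dq1 : OneForm Plane Torus := fun _ => ContinuousLinearMap.fst ℝ ℝ ℝ

/-- The 1-form `dq²`. -/
def dq2 : OneForm Plane Torus := fun _ => ContinuousLinearMap.snd ℝ ℝ ℝ

/-- The 2-form `dq¹ ∧ dq²`. -/
def areaForm : TwoForm where
  toFun q := (dq1 q).smulRight (dq2 q) - (dq2 q).smulRight (dq1 q)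
  smooth := by
    unfold dq1 dq2
    exact contMDiff_const
  alt q v := by simp [dq1, dq2, mul_comm]

/-- The interior product `ι_v σ = σ(v, ·)` with a constant vector field. -/
def interiorProduct (v : Plane) (σ : TwoForm) : OneForm Plane Torus := fun q => σ.toFun q v

theorem TwoForm.exists_bound (σ : TwoForm) : ∃ C : ℝ, ∀ q, ‖σ.toFun q‖ ≤ C := by
  obtain ⟨C, hC⟩ := (isCompact_univ (X := Torus)).exists_bound_of_continuousOn
    (f := σ.toFun) σ.smooth.continuous.continuousOn
  exact ⟨C, fun q => hC q (mem_univ q)⟩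

theorem norm_field_le (ζ : LoopVec) (s : UnitAddCircle) : ‖LoopVec.field ζ s‖ ≤ ‖ζ‖ :=
  ((ζ.1.1.1.norm_coe_le_norm s).trans (norm_fst_le ζ.1.1)).trans (norm_fst_le ζ)

theorem transgression_bound (σ : TwoForm) {C : ℝ} (hC : ∀ q, ‖σ.toFun q‖ ≤ C) (γ : Loop)
    (ζ : LoopVec) (s : UnitAddCircle) :
    ‖σ.toFun (Loop.pt γ s) (LoopVec.field ζ s) (Loop.vel γ s)‖ ≤
      C * ‖ζ‖ * ‖Loop.vel γ s‖ := by
  have hC0 : 0 ≤ C := (norm_nonneg (σ.toFun 0)).trans (hC 0)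
  refine (ContinuousLinearMap.le_opNorm₂ _ _ _).trans ?_
  gcongr
  · exact hC _
  · exact norm_field_le ζ s

theorem integrable_transgression (σ : TwoForm) (γ : Loop) (ζ : LoopVec) :
    Integrable (fun s => σ.toFun (Loop.pt γ s) (LoopVec.field ζ s) (Loop.vel γ s)) volume := by
  obtain ⟨C, hC⟩ := σ.exists_bound
  refine Integrable.mono' ((integrable_L2 γ.1.1.2).norm.const_mul (C * ‖ζ‖)) ?_
    (Filter.Eventually.of_forall fun s => transgression_bound σ hC γ ζ s)
  have hc : Continuous fun s => σ.toFun (Loop.pt γ s) (LoopVec.field ζ s) :=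
    (σ.smooth.continuous.comp γ.1.1.1.continuous).clm_apply ζ.1.1.1.continuous
  exact (ContinuousLinearMap.id ℝ (Plane →L[ℝ] ℝ)).aestronglyMeasurable_comp₂
    hc.aestronglyMeasurable (integrable_L2 γ.1.1.2).aestronglyMeasurable

/-- The transgression `ζ ↦ ∫₀¹ σ_{x(s)}(ζ(s), x'(s)) ds` of a 2-form, a 1-form on loop space. -/
def transgression (σ : TwoForm) : OneForm LoopVec Loop := fun γ =>
  LinearMap.mkContinuousOfExistsBound
    { toFun := fun ζ =>
        ∫ s : UnitAddCircle, σ.toFun (Loop.pt γ s) (LoopVec.field ζ s) (Loop.vel γ s)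
      map_add' := by
        intro ζ ξ
        rw [← integral_add (integrable_transgression σ γ ζ) (integrable_transgression σ γ ξ)]
        congr 1 with s
        have : LoopVec.field (ζ + ξ) s = LoopVec.field ζ s + LoopVec.field ξ s := rfl
        simp [this]
      map_smul' := by
        intro c ζ
        rw [RingHom.id_apply, ← integral_smul]
        congr 1 with s
        have : LoopVec.field (c • ζ) s = c • LoopVec.field ζ s := rfl
        simp [this] }
    (by
      obtain ⟨C, hC⟩ := σ.exists_bound
      refine ⟨C * ∫ s, ‖Loop.vel γ s‖, fun ζ => ?_⟩
      refine (norm_integral_le_of_norm_le ((integrable_L2 γ.1.1.2).norm.const_mul (C * ‖ζ‖))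
        (Filter.Eventually.of_forall fun s => transgression_bound σ hC γ ζ s)).trans (le_of_eq ?_)
      rw [integral_const_mul]
      exact mul_right_comm C ‖ζ‖ _)

/-- The transgression 1-form `τ` of `dq¹ ∧ dq²`. -/
def tau : OneForm LoopVec Loop := transgression areaForm

/-- In terms of `γ(t) = x(t / T)`, so that `γ'(t) = x'(t / T) / T`, the form `τ` is
`ζ ↦ ∫₀ᵀ (dq¹ ∧ dq²)(ζ, γ'(t)) dt`. -/
theorem tau_apply (γ : Loop) (hγ : γ ∈ freeLoops) (ζ : LoopVec) :
    tau γ ζ = ∫ t in (0 : ℝ)..γ.2, areaForm.toFun (Loop.curve γ t)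
      (LoopVec.field ζ ((t / γ.2 : ℝ) : UnitAddCircle))
      ((1 / γ.2) • Loop.vel γ ((t / γ.2 : ℝ) : UnitAddCircle)) := by
  have h0 : γ.2 ≠ 0 := (show 0 < γ.2 from hγ).ne'
  have h1 := AddCircle.intervalIntegral_preimage (1 : ℝ) 0 (fun s : UnitAddCircle =>
    areaForm.toFun (Loop.pt γ s) (LoopVec.field ζ s) (Loop.vel γ s))
  have h2 := intervalIntegral.integral_comp_div (a := 0) (b := γ.2) (fun r : ℝ =>
    areaForm.toFun (Loop.pt γ r) (LoopVec.field ζ r) (Loop.vel γ r)) h0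
  simp only [map_smul, intervalIntegral.integral_smul, Loop.curve]
  rw [h2, zero_div, div_self h0, smul_smul, one_div, inv_mul_cancel₀ h0, one_smul]
  rw [zero_add] at h1
  exact h1.symm

/-- The free-period action of the kinetic energy:
`𝔸_k(x, T) = T ∫₀¹ (|x'(s)|² / (2 T²) + k) ds`. -/
def action (g : TorusMetric) (k : ℝ) (γ : Loop) : ℝ :=
  γ.2 * ∫ s : UnitAddCircle,
    (1 / (2 * γ.2 ^ 2) * g.toFun (Loop.pt γ s) (Loop.vel γ s) (Loop.vel γ s) + k)

/-- The action 1-form `η_k = d𝔸_k + ∫₀¹ σ_{x(s)}(·, x'(s)) ds`. -/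
def eta (g : TorusMetric) (σ : TwoForm) (k : ℝ) : OneForm LoopVec Loop :=
  extDer (action g k) + transgression σ

end

end MagneticTorus

open MagneticTorus

/-!
On the plane, `σ - (∫ σ) dq¹ ∧ dq²` has a doubly periodic primitive `θ`. Integrating `θ` along
lifts of loops gives a function on the loop space whose differential is
`transgression σ - (∫ σ) • tau`, so `eta g σ k` is cohomologous to `(∫ σ) • tau` and everything
reduces to `tau`. The form `x dy` plays the role of `θ` for `tau` itself: the area `∫ x dy` below
a lift, corrected by a boundary term, is a primitive of `tau`, and changing the lift of a loop of
class `(a, b)` by `(m, n)` changes it by the integer `m b - n a`. Hence `tau` is closed with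
integral periods, and exact over the class `(0, 0)`; on the torus of straight loops of class
`(a, b)` it is the constant form `b dq¹ - a dq²`, which is exact only if it vanishes. Near loops
missing a neighbourhood of `q`, the area form may be replaced by a form of integral zero, whose
transgression is exact; exhausting by smaller neighbourhoods gives exactness over all loops
avoiding `q`.
-/

namespace MagneticTorus

noncomputable section

set_option maxSynthPendingDepth 3

section Superposition

universe v

variable {K : Type*} [TopologicalSpace K] [CompactSpace K]
  {E F : Type v} [NormedAddCommGroup E] [NormedSpace ℝ E] [NormedAddCommGroup F] [NormedSpace ℝ F]

/-- Pointwise application of a continuous family of linear maps to a continuous function. -/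
def applyL (K : Type*) [TopologicalSpace K] [CompactSpace K]
    (E F : Type v) [NormedAddCommGroup E] [NormedSpace ℝ E]
    [NormedAddCommGroup F] [NormedSpace ℝ F] :
    C(K, E →L[ℝ] F) →L[ℝ] C(K, E) →L[ℝ] C(K, F) :=
  LinearMap.mkContinuous₂
    (LinearMap.mk₂ ℝ (fun (A : C(K, E →L[ℝ] F)) (ξ : C(K, E)) =>
        (⟨fun s => A s (ξ s), A.continuous.clm_apply ξ.continuous⟩ : C(K, F)))
      (fun A B ξ => by ext; simp) (fun c A ξ => by ext; simp)
      (fun A ξ ζ => by ext; simp) (fun c A ξ => by ext; simp)) 1 (by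
    intro A ξ
    rw [one_mul]
    refine (ContinuousMap.norm_le _ (by positivity)).2 fun s => ?_
    exact (A s).le_of_opNorm_le_of_le (A.norm_coe_le_norm s) (ξ.norm_coe_le_norm s))

/-- The superposition operator `ξ ↦ f ∘ ξ`. -/
def superpose (f : C(E, F)) (ξ : C(K, E)) : C(K, F) := f.comp ξ

theorem hasFDerivAt_superpose (f : C(E, F)) (f' : C(E, E →L[ℝ] F))
    (hf : ∀ x, HasFDerivAt f (f' x) x) (ξ : C(K, E)) :
    HasFDerivAt (superpose f) (applyL K E F (superpose f' ξ)) ξ := by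
  rw [hasFDerivAt_iff_isLittleO_nhds_zero, Asymptotics.isLittleO_iff]
  intro ε hε
  have hcont := (f'.continuous_postcomp (X := K)).continuousAt (x := ξ)
  obtain ⟨δ, hδ, hδ'⟩ := Metric.continuousAt_iff.1 hcont ε hε
  filter_upwards [Metric.ball_mem_nhds (0 : C(K, E)) hδ] with ζ hζ
  have hζ' : ‖ζ‖ < δ := by simpa using hζ
  refine (ContinuousMap.norm_le _ (by positivity)).2 fun s => ?_
  have hbound : ∀ e ∈ Metric.ball (0 : E) δ, ‖f' (ξ s + e) - f' (ξ s)‖ ≤ ε := by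
    intro e he
    have he' : ‖e‖ < δ := by simpa using he
    have hdist : dist (ξ + ContinuousMap.const K e) ξ < δ := by
      rw [dist_eq_norm, add_sub_cancel_left]
      exact ((ContinuousMap.norm_le _ (norm_nonneg e)).2 fun _ => le_rfl).trans_lt he'
    have heval := (ContinuousMap.norm_coe_le_norm
      (superpose f' (ξ + ContinuousMap.const K e) - superpose f' ξ) s)
    have hclose := hδ' hdist
    rw [dist_eq_norm] at hclose
    exact heval.trans hclose.le
  have hs : ζ s ∈ Metric.ball (0 : E) δ := by
    simpa using (ζ.norm_coe_le_norm s).trans_lt hζ'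
  have hmv := (convex_ball (0 : E) δ).norm_image_sub_le_of_norm_hasFDerivWithin_le'
    (f := fun e => f (ξ s + e)) (f' := fun e => f' (ξ s + e)) (φ := f' (ξ s)) (C := ε)
    (fun e _ => by
      have := (hf (ξ s + e)).comp e ((hasFDerivAt_id e).const_add (ξ s))
      exact this.hasFDerivWithinAt) hbound (Metric.mem_ball_self hδ) hs
  simp only [add_zero, sub_zero] at hmv
  refine le_trans ?_ (hmv.trans ?_)
  · exact le_of_eq rfl
  · gcongr
    exact ζ.norm_coe_le_norm s

theorem contDiff_superpose_nat (n : ℕ) : ∀ {F : Type v} [NormedAddCommGroup F] [NormedSpace ℝ F]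
    (f : C(E, F)), ContDiff ℝ n f → ContDiff ℝ n (superpose (K := K) f) := by
  induction n with
  | zero =>
    intro F _ _ f _
    exact contDiff_zero.2 f.continuous_postcomp
  | succ n ih =>
    intro F _ _ f hf
    push_cast at hf ⊢
    rw [contDiff_succ_iff_hasFDerivAt] at hf ⊢
    obtain ⟨f', hf', hd⟩ := hf
    let g : C(E, E →L[ℝ] F) := ⟨f', hf'.continuous⟩
    exact ⟨fun ξ => applyL K E F (superpose g ξ), ContDiff.comp
        (ContinuousLinearMap.contDiff (𝕜 := ℝ) (E := C(K, E →L[ℝ] F))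
          (F := C(K, E) →L[ℝ] C(K, F)) (applyL K E F)) (ih g hf'),
      fun ξ => hasFDerivAt_superpose f g hd ξ⟩

theorem contDiff_superpose (f : C(E, F)) (hf : ContDiff ℝ ∞ f) :
    ContDiff ℝ ∞ (superpose (K := K) f) :=
  contDiff_infty.2 fun n => contDiff_superpose_nat n f (contDiff_infty.1 hf n)

end Superposition

section TranslationCalculus

variable {E X F : Type*} [NormedAddCommGroup E] [NormedSpace ℝ E]
  [AddCommGroup X] [TopologicalSpace X] [IsTopologicalAddGroup X] [ChartedSpace E X]
  [NormedAddCommGroup F] [NormedSpace ℝ F]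

/-- The charts of `X` are those given by the homomorphism `p`, as in `translationCharts`. -/
structure HasTranslationCharts (p : E →+ X) : Prop where
  isLocalHomeomorph : IsLocalHomeomorph p
  chartAt_eq : ∀ x, chartAt E x = (translateParam p isLocalHomeomorph x).symm

theorem hasTranslationCharts_proj : HasTranslationCharts proj :=
  ⟨isLocalHomeomorph_proj, fun _ => rfl⟩

theorem hasTranslationCharts_freeExp : HasTranslationCharts freeExp :=
  ⟨isLocalHomeomorph_freeExp, fun _ => rfl⟩

namespace HasTranslationCharts

variable {p : E →+ X}

theorem extChartAt_symm (hp : HasTranslationCharts p) (x : X) :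
    ⇑(extChartAt 𝓘(ℝ, E) x).symm = fun e => x + p e := by
  funext e
  simp [extChartAt, hp.chartAt_eq, translateParam_apply]

theorem extChartAt_eventually (hp : HasTranslationCharts p) (x : X) :
    ∀ᶠ e in 𝓝 (0 : E), extChartAt 𝓘(ℝ, E) x (x + p e) = e := by
  filter_upwards [(translateParam p hp.isLocalHomeomorph x).open_source.mem_nhds
    (zero_mem_translateParam p hp.isLocalHomeomorph x)] with e he
  have := (translateParam p hp.isLocalHomeomorph x).left_inv he
  simpa [extChartAt, hp.chartAt_eq, translateParam_apply] using this

theorem extChartAt_self (hp : HasTranslationCharts p) (x : X) : extChartAt 𝓘(ℝ, E) x x = 0 := by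
  simpa using (hp.extChartAt_eventually x).self_of_nhds

theorem map_nhds (hp : HasTranslationCharts p) (x : X) (e : E) :
    Filter.map (fun e' => x + p e') (𝓝 e) = 𝓝 (x + p e) :=
  (isLocalHomeomorph_translate p hp.isLocalHomeomorph x).map_nhds_eq e

theorem map_nhds_zero (hp : HasTranslationCharts p) (x : X) :
    Filter.map (fun e => x + p e) (𝓝 0) = 𝓝 x := by
  simpa using hp.map_nhds x 0

theorem continuousAt_iff (hp : HasTranslationCharts p) {Y : Type*} [TopologicalSpace Y]
    {f : X → Y} {x : X} : ContinuousAt f x ↔ ContinuousAt (fun e => f (x + p e)) 0 := by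
  rw [ContinuousAt, ← hp.map_nhds_zero x, Filter.tendsto_map'_iff]
  simp [ContinuousAt, Function.comp_def]

theorem contMDiffAt_iff_zero (hp : HasTranslationCharts p) {n : WithTop ℕ∞} {f : X → F} {x : X} :
    ContMDiffAt 𝓘(ℝ, E) 𝓘(ℝ, F) n f x ↔ ContDiffAt ℝ n (fun e => f (x + p e)) 0 := by
  rw [contMDiffAt_iff, hp.extChartAt_self, hp.extChartAt_symm, modelWithCornersSelf_coe, range_id,
    contDiffWithinAt_univ, hp.continuousAt_iff]
  exact and_iff_right_of_imp fun h => h.continuousAt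

theorem contMDiffAt_iff (hp : HasTranslationCharts p) {n : WithTop ℕ∞} {f : X → F} {x : X}
    {e : E} :
    ContMDiffAt 𝓘(ℝ, E) 𝓘(ℝ, F) n f (x + p e) ↔ ContDiffAt ℝ n (fun e' => f (x + p e')) e := by
  rw [hp.contMDiffAt_iff_zero]
  have htranslate :
      (fun e' => f (x + p e + p e')) = (fun e' => f (x + p e')) ∘ fun e' => e + e' := by
    funext e'
    simp [add_assoc]
  rw [htranslate]
  constructor <;> intro h
  · have h' : ContDiffAt ℝ n (fun z : E => z - e) e := by fun_prop
    rw [← sub_self e] at h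
    simpa [Function.comp_def] using ContDiffAt.comp (f := fun z : E => z - e) e h h'
  · refine ContDiffAt.comp 0 ?_ (by fun_prop)
    simpa using h

theorem contMDiff_iff (hp : HasTranslationCharts p) (hsurj : Function.Surjective p)
    {n : WithTop ℕ∞} {f : X → F} :
    ContMDiff 𝓘(ℝ, E) 𝓘(ℝ, F) n f ↔ ContDiff ℝ n (fun e => f (p e)) := by
  simp only [ContMDiff, contDiff_iff_contDiffAt, hsurj.forall]
  refine forall_congr' fun e => ?_
  simpa using hp.contMDiffAt_iff (n := n) (f := f) (x := 0) (e := e)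

theorem hasMFDerivAt (hp : HasTranslationCharts p) {f : X → F} {x : X} {e : E} {f' : E →L[ℝ] F}
    (h : HasFDerivAt (fun e' => f (x + p e')) f' e) :
    HasMFDerivAt 𝓘(ℝ, E) 𝓘(ℝ, F) f (x + p e) f' := by
  have hshift : HasFDerivAt (fun e' => f (x + p e + p e')) f' 0 := by
    rw [← add_zero e] at h
    simpa [Function.comp_def, add_assoc] using h.comp 0 ((hasFDerivAt_id (0 : E)).const_add e)
  refine ⟨hp.continuousAt_iff.2 hshift.continuousAt, ?_⟩
  rw [writtenInExtChartAt, hp.extChartAt_self, hp.extChartAt_symm]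
  exact hshift.hasFDerivWithinAt

theorem mfderiv_eq (hp : HasTranslationCharts p) {f : X → F} {x : X} {e : E}
    (h : DifferentiableAt ℝ (fun e' => f (x + p e')) e) :
    mfderiv 𝓘(ℝ, E) 𝓘(ℝ, F) f (x + p e) = fderiv ℝ (fun e' => f (x + p e')) e :=
  (hp.hasMFDerivAt h.hasFDerivAt).mfderiv

theorem hasMFDerivAt_of_linear (hp : HasTranslationCharts p) {E' X' : Type*}
    [NormedAddCommGroup E'] [NormedSpace ℝ E'] [AddCommGroup X'] [TopologicalSpace X']
    [IsTopologicalAddGroup X'] [ChartedSpace E' X'] {p' : E' →+ X'}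
    (hp' : HasTranslationCharts p') {φ : X → X'} {x : X} (L : E →L[ℝ] E')
    (h : ∀ e, φ (x + p e) = φ x + p' (L e)) :
    ContMDiffAt 𝓘(ℝ, E) 𝓘(ℝ, E') ∞ φ x ∧ HasMFDerivAt 𝓘(ℝ, E) 𝓘(ℝ, E') φ x L := by
  have hL : Filter.Tendsto L (𝓝 0) (𝓝 0) := by simpa using L.continuous.tendsto 0
  have hc : ContinuousAt φ x := by
    simp only [hp.continuousAt_iff, h]
    rw [ContinuousAt, map_zero, map_zero, add_zero]
    exact (show Filter.Tendsto (fun e => φ x + p' e) (𝓝 0) (𝓝 (φ x)) from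
      (hp'.map_nhds_zero (φ x)).le).comp hL
  have hev : ∀ᶠ e in 𝓝 (0 : E), extChartAt 𝓘(ℝ, E') (φ x) (φ (x + p e)) = L e := by
    filter_upwards [hL.eventually (hp'.extChartAt_eventually (φ x))] with e he
    rw [h, he]
  constructor
  · rw [_root_.contMDiffAt_iff, hp.extChartAt_self, hp.extChartAt_symm]
    exact ⟨hc, (L.contDiff.contDiffAt.congr_of_eventuallyEq hev).contDiffWithinAt⟩
  · refine ⟨hc, ?_⟩
    rw [writtenInExtChartAt, hp.extChartAt_self, hp.extChartAt_symm]
    exact (L.hasFDerivAt.congr_of_eventuallyEq hev).hasFDerivWithinAt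

theorem exists_eventually_eq (hp : HasTranslationCharts p) {Y : Type*} (x : X) (Ψ : E → Y) :
    ∃ f : X → Y, ∀ᶠ e in 𝓝 (0 : E), f (x + p e) = Ψ e :=
  ⟨fun y => Ψ (extChartAt 𝓘(ℝ, E) x y),
    (hp.extChartAt_eventually x).mono fun _ he => congrArg Ψ he⟩

end HasTranslationCharts

end TranslationCalculus

section OneForms

variable {E X : Type*} [NormedAddCommGroup E] [NormedSpace ℝ E] [TopologicalSpace X]
  [ChartedSpace E X]

/-- The real-valued function `Q` represents a smooth primitive of the 1-form `α` on `U` with values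
in `ℝ / Pℤ`: only `Q` modulo `P` is continuous, so a primitive on a covering space with periods in
`Pℤ` gives such a `Q` after any choice of preimages. For `P = 0` it is an ordinary primitive. -/
def IsPrimitiveMod (P : ℝ) (Q : X → ℝ) (α : OneForm E X) (U : Set X) : Prop :=
  ∀ x ∈ U, ∃ h : X → ℝ, ∀ᶠ y in 𝓝 x,
    ContMDiffAt 𝓘(ℝ, E) 𝓘(ℝ, ℝ) ∞ h y ∧ α y = extDer h y ∧ (h y : AddCircle P) = Q y

namespace IsPrimitiveMod

variable {P : ℝ} {Q : X → ℝ} {α : OneForm E X} {U : Set X}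

theorem mono {V : Set X} (hQ : IsPrimitiveMod P Q α U) (hVU : V ⊆ U) : IsPrimitiveMod P Q α V :=
  fun x hx => hQ x (hVU hx)

theorem const_smul (hQ : IsPrimitiveMod P Q α U) (c : ℝ) :
    IsPrimitiveMod (c * P) (c • Q) (c • α) U := by
  intro x hx
  obtain ⟨h, hh⟩ := hQ x hx
  refine ⟨c • h, hh.mono fun y ⟨hs, hα, hQy⟩ => ⟨?_, ?_, ?_⟩⟩
  · exact (contDiff_const_smul c).contMDiff.contMDiffAt.comp y hs
  · rw [Pi.smul_apply, hα]
    exact (const_smul_mfderiv (hs.mdifferentiableAt (by simp)) c).symm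
  · rw [← sub_eq_zero, ← AddCircle.coe_sub, AddCircle.coe_eq_zero_iff] at hQy ⊢
    obtain ⟨n, hn⟩ := hQy
    refine ⟨n, ?_⟩
    rw [← mul_smul_comm, hn, mul_sub]
    rfl

theorem zero : IsPrimitiveMod P 0 (0 : OneForm E X) U := fun _ _ =>
  ⟨0, .of_forall fun _ => ⟨contMDiffAt_const, (mfderiv_const (c := (0 : ℝ))).symm, rfl⟩⟩

theorem exists_of_sub_mem_exactForms {β : OneForm E X} (hQ : IsPrimitiveMod P Q β U)
    (hU : IsOpen U) (h : α - β ∈ exactForms U) : ∃ Q', IsPrimitiveMod P Q' α U := by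
  obtain ⟨f, hf⟩ := h
  refine ⟨Q + f, fun x hx => ?_⟩
  obtain ⟨h, hh⟩ := hQ x hx
  refine ⟨h + f, ?_⟩
  filter_upwards [hh, hU.mem_nhds hx] with y ⟨hs, hβ, hQy⟩ hy
  refine ⟨hs.add (hf y hy).1, ?_, ?_⟩
  · refine (sub_eq_iff_eq_add'.1 (hf y hy).2).trans ?_
    rw [hβ]
    exact (mfderiv_add (hs.mdifferentiableAt (by simp))
      ((hf y hy).1.mdifferentiableAt (by simp))).symm
  · rw [Pi.add_apply, Pi.add_apply, AddCircle.coe_add, AddCircle.coe_add, hQy]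

theorem mem_exactForms (hQ : IsPrimitiveMod 0 Q α U) : α ∈ exactForms U := by
  refine ⟨Q, fun x hx => ?_⟩
  obtain ⟨h, hh⟩ := hQ x hx
  have heq : Q =ᶠ[𝓝 x] h := hh.mono fun y hy => by
    have hz := hy.2.2
    rw [← sub_eq_zero, ← AddCircle.coe_sub, AddCircle.coe_eq_zero_iff] at hz
    obtain ⟨n, hn⟩ := hz
    rw [smul_zero] at hn
    linarith
  obtain ⟨hs, hα, -⟩ := hh.self_of_nhds
  exact ⟨hs.congr_of_eventuallyEq heq, hα.trans heq.mfderiv_eq.symm⟩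

theorem exists_continuous_lift (hQ : IsPrimitiveMod P Q α U) {c : ℝ → X}
    (hc : ContinuousOn c (Icc 0 1)) (hcU : MapsTo c (Icc 0 1) U) :
    ∃ φ : ℝ → ℝ, ContinuousOn φ (Icc 0 1) ∧
      ∀ t ∈ Icc (0 : ℝ) 1, (φ t : AddCircle P) = Q (c t) := by
  have hcont : ContinuousOn (fun t => (Q (c t) : AddCircle P)) (Icc 0 1) := by
    intro t ht
    obtain ⟨h, hh⟩ := hQ (c t) (hcU ht)
    have hQc : ContinuousAt (fun y => (Q y : AddCircle P)) (c t) :=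
      (((AddCircle.isCoveringMap_coe P).continuous.continuousAt).comp
        hh.self_of_nhds.1.continuousAt).congr (hh.mono fun y hy => hy.2.2)
    exact hQc.comp_continuousWithinAt (hc t ht)
  let γ : C(unitInterval, AddCircle P) :=
    ⟨fun t => (Q (c t) : AddCircle P), continuousOn_iff_continuous_domRestrict.1 hcont⟩
  obtain ⟨Γ, hΓ, -⟩ := (AddCircle.isCoveringMap_coe P).exists_path_lifts γ (Q (c 0)) rfl
  refine ⟨fun t => Γ (projIcc 0 1 zero_le_one t),
    (Γ.continuous.comp continuous_projIcc).continuousOn, fun t ht => ?_⟩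
  simp only [projIcc_of_mem zero_le_one ht]
  exact congrFun hΓ ⟨t, ht⟩

theorem hasDerivWithinAt_lift (hQ : IsPrimitiveMod P Q α U) {c : ℝ → X}
    (hc : ContMDiffOn 𝓘(ℝ, ℝ) 𝓘(ℝ, E) ∞ c (Icc 0 1)) (hcU : MapsTo c (Icc 0 1) U) {φ : ℝ → ℝ}
    (hφ : ContinuousOn φ (Icc 0 1)) (hφQ : ∀ t ∈ Icc (0 : ℝ) 1, (φ t : AddCircle P) = Q (c t))
    {t : ℝ} (ht : t ∈ Icc (0 : ℝ) 1) :
    ContDiffWithinAt ℝ ∞ φ (Icc 0 1) t ∧ derivWithin φ (Icc 0 1) t =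
      α (c t) (mfderivWithin 𝓘(ℝ, ℝ) 𝓘(ℝ, E) c (Icc 0 1) t (1 : ℝ) : E) := by
  obtain ⟨h, hh⟩ := hQ (c t) (hcU ht)
  obtain ⟨hs, hα, ht0⟩ := hh.self_of_nhds
  have hhc : ContDiffWithinAt ℝ ∞ (h ∘ c) (Icc 0 1) t :=
    contMDiffWithinAt_iff_contDiffWithinAt.1 (hs.comp_contMDiffWithinAt t (hc t ht))
  have heq : φ =ᶠ[𝓝[Icc 0 1] t] fun s => h (c s) + (φ t - h (c t)) := by
    obtain ⟨e, he, hcoe⟩ := AddCircle.isLocalHomeomorph_coe P (φ t)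
    have hg : ContinuousWithinAt (fun s => h (c s) + (φ t - h (c t))) (Icc 0 1) t :=
      hhc.continuousWithinAt.add continuousWithinAt_const
    filter_upwards [hφ t ht (e.open_source.mem_nhds he),
      hg (by simpa using e.open_source.mem_nhds he), self_mem_nhdsWithin,
      (hc t ht).continuousWithinAt hh] with s hs1 hs2 hs hcs
    refine e.injOn hs1 hs2 ?_
    rw [← hcoe, AddCircle.coe_add, AddCircle.coe_sub, hφQ s hs, hφQ t ht, ht0, sub_self, add_zero]
    exact hcs.2.2.symm
  refine ⟨(hhc.add contDiffWithinAt_const).congr_of_eventuallyEq heq (by simp), ?_⟩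
  have hcomp := HasMFDerivAt.comp_hasMFDerivWithinAt t
    (hs.mdifferentiableAt (by simp)).hasMFDerivAt
    ((hc t ht).mdifferentiableWithinAt (by simp)).hasMFDerivWithinAt
  have hderiv : HasFDerivWithinAt (h ∘ c) ((extDer (E := E) h (c t)).comp
      (mfderivWithin 𝓘(ℝ, ℝ) 𝓘(ℝ, E) c (Icc 0 1) t : ℝ →L[ℝ] E)) (Icc 0 1) t :=
    hasMFDerivWithinAt_iff_hasFDerivWithinAt.1 hcomp
  rw [heq.derivWithin_eq (by simp), hα]
  exact (hderiv.hasDerivWithinAt.add_const _).derivWithin (uniqueDiffOn_Icc zero_lt_one t ht)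

theorem coe_pathIntegral (hQ : IsPrimitiveMod P Q α U) {c : ℝ → X}
    (hc : ContMDiffOn 𝓘(ℝ, ℝ) 𝓘(ℝ, E) ∞ c (Icc 0 1)) (hcU : MapsTo c (Icc 0 1) U) :
    (pathIntegral α c : AddCircle P) = (Q (c 1) : AddCircle P) - (Q (c 0) : AddCircle P) := by
  obtain ⟨φ, hφ, hφQ⟩ := hQ.exists_continuous_lift hc.continuousOn hcU
  have hd := fun t ht => hQ.hasDerivWithinAt_lift (t := t) hc hcU hφ hφQ ht
  have hint : pathIntegral α c = φ 1 - φ 0 := by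
    rw [← intervalIntegral.integral_derivWithin_Icc_of_contDiffOn_Icc
      (fun t ht => (hd t ht).1.of_le (by simp)) zero_le_one]
    refine intervalIntegral.integral_congr fun t ht => ?_
    rw [uIcc_of_le zero_le_one] at ht
    exact (hd t ht).2.symm
  rw [hint, AddCircle.coe_sub, hφQ 1 (by simp), hφQ 0 (by simp)]

theorem periods_le_zmultiples (hQ : IsPrimitiveMod P Q α U) :
    periods α U ≤ AddSubgroup.zmultiples P := by
  rintro _ ⟨z, ⟨hz, hz0⟩, rfl⟩
  rw [← QuotientAddGroup.eq_zero_iff]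
  let Q' : (X →₀ ℤ) →+ AddCircle P :=
    Finsupp.liftAddHom fun x => zmultiplesHom _ (Q x : AddCircle P)
  suffices h : (chainIntegral α z : AddCircle P) = Q' (boundary X z) by
    rw [hz0, map_zero] at h
    exact h
  have hterm : ∀ c ∈ z.support,
      ((z c * pathIntegral α c : ℝ) : AddCircle P) =
        Q' (.single (c 1) (z c) - .single (c 0) (z c)) := by
    intro c hc
    have hpath := hQ.coe_pathIntegral (hz c hc).1 (hz c hc).2
    rw [← zsmul_eq_mul, AddCircle.coe_zsmul, hpath, map_sub]
    simp [Q', smul_sub]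
  have hleft : (chainIntegral α z : AddCircle P) =
      ∑ c ∈ z.support, ((z c * pathIntegral α c : ℝ) : AddCircle P) :=
    map_sum (QuotientAddGroup.mk' (AddSubgroup.zmultiples P)) _ _
  have hright : Q' (boundary X z) =
      ∑ c ∈ z.support, Q' (.single (c 1) (z c) - .single (c 0) (z c)) := map_sum Q' _ _
  rw [hleft, hright]
  exact Finset.sum_congr rfl hterm

end IsPrimitiveMod

theorem pullback_mem_exactForms {F Y : Type*} [NormedAddCommGroup F] [NormedSpace ℝ F]
    [TopologicalSpace Y] [ChartedSpace F Y] {φ : X → Y} (hφ : ContMDiff 𝓘(ℝ, E) 𝓘(ℝ, F) ∞ φ)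
    {α : OneForm F Y} {U : Set Y} (hα : α ∈ exactForms U) :
    pullback φ α ∈ exactForms (E := E) (φ ⁻¹' U) := by
  obtain ⟨f, hf⟩ := hα
  refine ⟨f ∘ φ, fun x hx => ⟨(hf _ hx).1.comp x (hφ x), ?_⟩⟩
  rw [pullback, (hf _ hx).2]
  exact (mfderiv_comp x ((hf _ hx).1.mdifferentiableAt (by simp))
    ((hφ x).mdifferentiableAt (by simp))).symm

theorem cohClass_eq_iff {U : Set X} {α β : OneForm E X} (hα : α ∈ closedForms U)
    (hβ : β ∈ closedForms U) : cohClass U α hα = cohClass U β hβ ↔ α - β ∈ exactForms U :=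
  Submodule.Quotient.eq _

theorem cohClass_eq_zero_iff {U : Set X} {α : OneForm E X} (hα : α ∈ closedForms U) :
    cohClass U α hα = 0 ↔ α ∈ exactForms U :=
  Submodule.Quotient.mk_eq_zero _

end OneForms

namespace HasTranslationCharts

variable {E X : Type*} [NormedAddCommGroup E] [NormedSpace ℝ E] [AddCommGroup X]
  [TopologicalSpace X] [IsTopologicalAddGroup X] [ChartedSpace E X] {p : E →+ X}
  {P : ℝ} {Q : X → ℝ} {α : OneForm E X} {U : Set X}

theorem isPrimitiveMod (hp : HasTranslationCharts p)
    (h : ∀ x ∈ U, ∃ Ψ : E → ℝ, ContDiff ℝ ∞ Ψ ∧ ∀ᶠ e in 𝓝 (0 : E),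
      α (x + p e) = fderiv ℝ Ψ e ∧ (Ψ e : AddCircle P) = Q (x + p e)) :
    IsPrimitiveMod P Q α U := by
  intro x hx
  obtain ⟨Ψ, hΨ, hαQ⟩ := h x hx
  obtain ⟨f, hf⟩ := hp.exists_eventually_eq x Ψ
  refine ⟨f, ?_⟩
  rw [← hp.map_nhds_zero x, Filter.eventually_map]
  filter_upwards [hαQ, hf.eventually_nhds] with e ⟨hα, hQ⟩ hfe
  have hdiff : ContDiffAt ℝ ∞ (fun e' => f (x + p e')) e :=
    hΨ.contDiffAt.congr_of_eventuallyEq hfe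
  refine ⟨hp.contMDiffAt_iff.2 hdiff, ?_, by rw [hfe.self_of_nhds, hQ]⟩
  rw [hα, ← Filter.EventuallyEq.fderiv_eq hfe]
  exact (hp.mfderiv_eq (hdiff.differentiableAt (by simp))).symm

theorem mem_closedForms (hp : HasTranslationCharts p) (hQ : IsPrimitiveMod P Q α U) :
    α ∈ closedForms U := by
  intro x hx
  obtain ⟨h, hh⟩ := hQ x hx
  set Ψ : E → ℝ := fun e => h (x + p e)
  have hΨ : ContDiffAt ℝ ∞ Ψ 0 := hp.contMDiffAt_iff_zero.1 hh.self_of_nhds.1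
  have hα : (fun e => α (x + p e)) =ᶠ[𝓝 0] fderiv ℝ Ψ := by
    rw [← hp.map_nhds_zero x, Filter.eventually_map] at hh
    filter_upwards [hh] with e ⟨hs, hαh, _⟩
    rw [hαh]
    exact hp.mfderiv_eq ((hp.contMDiffAt_iff.1 hs).differentiableAt (by simp))
  have hΨ' : ContDiffAt ℝ ∞ (fderiv ℝ Ψ) 0 := hΨ.fderiv_right (by simp)
  have hαs : ContDiffAt ℝ ∞ (fun e => α (x + p e)) 0 := hΨ'.congr_of_eventuallyEq hα
  have hder : formDer α x = fderiv ℝ (fderiv ℝ Ψ) 0 := by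
    have := hp.mfderiv_eq (hαs.differentiableAt (by simp))
    rwa [map_zero, add_zero, hα.fderiv_eq] at this
  refine ⟨hp.contMDiffAt_iff_zero.2 hαs, fun v w => ?_⟩
  rw [hder]
  have hsymm : IsSymmSndFDerivAt ℝ Ψ 0 := hΨ.isSymmSndFDerivAt (by
    rw [minSmoothness_of_isRCLikeNormedField]
    exact WithTop.coe_le_coe.2 le_top)
  exact hsymm v w

theorem exactForms_le_closedForms (hp : HasTranslationCharts p) (hU : IsOpen U) :
    exactForms (E := E) U ≤ closedForms U := fun α hα => by
  obtain ⟨f, hf⟩ := IsPrimitiveMod.zero (P := 0).exists_of_sub_mem_exactForms hU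
    ((sub_zero α).symm ▸ hα)
  exact hp.mem_closedForms hf

theorem eventually_sub_eq_of_extDer_eq (hp : HasTranslationCharts p) {f g : X → ℝ} {x : X}
    (h : ∀ᶠ y in 𝓝 x, ContMDiffAt 𝓘(ℝ, E) 𝓘(ℝ, ℝ) ∞ f y ∧ ContMDiffAt 𝓘(ℝ, E) 𝓘(ℝ, ℝ) ∞ g y ∧
      extDer (E := E) f y = extDer g y) : ∀ᶠ y in 𝓝 x, f y - f x = g y - g x := by
  rw [← hp.map_nhds_zero x, Filter.eventually_map] at h ⊢
  obtain ⟨r, hr, hball⟩ := Metric.eventually_nhds_iff_ball.1 h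
  have hdiff : ∀ e ∈ Metric.ball (0 : E) r,
      HasFDerivAt (fun e' => f (x + p e') - g (x + p e')) (0 : E →L[ℝ] ℝ) e := by
    intro e he
    obtain ⟨hf, hg, hfg⟩ := hball e he
    have hf' := (hp.contMDiffAt_iff.1 hf).differentiableAt (by simp)
    have hg' := (hp.contMDiffAt_iff.1 hg).differentiableAt (by simp)
    have hfg' := (hp.mfderiv_eq hf').symm.trans (hfg.trans (hp.mfderiv_eq hg'))
    have hsub := hf'.hasFDerivAt.sub hg'.hasFDerivAt
    rwa [hfg', sub_self] at hsub
  filter_upwards [Metric.ball_mem_nhds (0 : E) hr] with e he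
  have hconst := (convex_ball (0 : E) r).is_const_of_fderivWithin_eq_zero (𝕜 := ℝ)
    (fun e he => (hdiff e he).differentiableAt.differentiableWithinAt)
    (fun e he => ((hdiff e he).hasFDerivWithinAt.fderivWithin
      (Metric.isOpen_ball.uniqueDiffWithinAt he))) he (Metric.mem_ball_self hr)
  simp only [map_zero, add_zero] at hconst
  linarith

theorem sub_eq_of_extDer_eq (hp : HasTranslationCharts p) {f g : X → ℝ} {V s : Set X}
    (hV : IsOpen V) (h : ∀ y ∈ V, ContMDiffAt 𝓘(ℝ, E) 𝓘(ℝ, ℝ) ∞ f y ∧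
      ContMDiffAt 𝓘(ℝ, E) 𝓘(ℝ, ℝ) ∞ g y ∧ extDer (E := E) f y = extDer g y)
    (hs : IsPreconnected s) (hsV : s ⊆ V) {x y : X} (hx : x ∈ s) (hy : y ∈ s) :
    f y - f x = g y - g x := by
  refine hs.induction₂ (fun x y => f y - f x = g y - g x) (fun x hx => ?_)
    (fun _ _ _ _ _ _ h₁ h₂ => ?_) (fun _ _ _ _ h₁ => ?_) hx hy
  · exact nhdsWithin_le_nhds (hp.eventually_sub_eq_of_extDer_eq
      (Filter.mem_of_superset (hV.mem_nhds (hsV hx)) h))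
  all_goals linarith

end HasTranslationCharts

section DirectedUnion

variable {X ι : Type*} [TopologicalSpace X] [LocallyConnectedSpace X] {U : ι → Set X}

theorem exists_mem_connectedComponentIn_of_directed (hU : ∀ i, IsOpen (U i))
    (hdir : Directed (· ⊆ ·) U) {x y : X} (hy : y ∈ connectedComponentIn (⋃ i, U i) x) :
    ∃ i, x ∈ U i ∧ y ∈ connectedComponentIn (U i) x := by
  have hx : x ∈ ⋃ i, U i := connectedComponentIn_nonempty_iff.1 ⟨y, hy⟩
  refine isPreconnected_connectedComponentIn.induction₂
    (fun x y => ∃ i, x ∈ U i ∧ y ∈ connectedComponentIn (U i) x)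
    (fun z hz => ?_) ?_ ?_ (mem_connectedComponentIn hx) hy
  · obtain ⟨i, hi⟩ := mem_iUnion.1 (connectedComponentIn_subset _ _ hz)
    filter_upwards [nhdsWithin_le_nhds (connectedComponentIn_mem_nhds ((hU i).mem_nhds hi))]
      with w hw using ⟨i, hi, hw⟩
  · rintro a b c - - - ⟨i, ha, hb⟩ ⟨j, -, hc⟩
    obtain ⟨k, hik, hjk⟩ := hdir i j
    refine ⟨k, hik ha, ?_⟩
    rw [connectedComponentIn_eq (connectedComponentIn_mono a hik hb)]
    exact connectedComponentIn_mono b hjk hc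
  · rintro a b - - ⟨i, ha, hb⟩
    refine ⟨i, connectedComponentIn_subset _ _ hb, ?_⟩
    rw [← connectedComponentIn_eq hb]
    exact mem_connectedComponentIn ha

end DirectedUnion

namespace HasTranslationCharts

variable {E X ι : Type*} [NormedAddCommGroup E] [NormedSpace ℝ E] [AddCommGroup X]
  [TopologicalSpace X] [IsTopologicalAddGroup X] [ChartedSpace E X] {p : E →+ X}
  {α : OneForm E X} {U : ι → Set X}

theorem sub_eq_sub_of_directed (hp : HasTranslationCharts p) (hU : ∀ i, IsOpen (U i))
    (hdir : Directed (· ⊆ ·) U) {f : ι → X → ℝ}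
    (hf : ∀ i, ∀ x ∈ U i, ContMDiffAt 𝓘(ℝ, E) 𝓘(ℝ, ℝ) ∞ (f i) x ∧ α x = extDer (f i) x)
    {i j : ι} {x y : X} (hxi : x ∈ U i) (hyi : y ∈ connectedComponentIn (U i) x)
    (hxj : x ∈ U j) (hyj : y ∈ connectedComponentIn (U j) x) :
    f i x - f i y = f j x - f j y := by
  have hmono : ∀ {i k}, U i ⊆ U k → x ∈ U i → y ∈ connectedComponentIn (U i) x →
      f i x - f i y = f k x - f k y := fun {i k} hik hx hy =>
    hp.sub_eq_of_extDer_eq (hU i)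
      (fun z hz => ⟨(hf i z hz).1, (hf k z (hik hz)).1,
        (hf i z hz).2.symm.trans (hf k z (hik hz)).2⟩)
      isPreconnected_connectedComponentIn (connectedComponentIn_subset _ _) hy
      (mem_connectedComponentIn hx)
  obtain ⟨k, hik, hjk⟩ := hdir i j
  exact (hmono hik hxi hyi).trans (hmono hjk hxj hyj).symm

/- On a connected component of the union, normalize the primitives to vanish at a base point; two
of them then agree wherever both are defined on a connected set containing that point. -/
theorem iUnion_mem_exactForms (hp : HasTranslationCharts p) (hU : ∀ i, IsOpen (U i))
    (hdir : Directed (· ⊆ ·) U) (hα : ∀ i, α ∈ exactForms (U i)) :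
    α ∈ exactForms (⋃ i, U i) := by
  have : LocallyConnectedSpace X := ChartedSpace.locallyConnectedSpace E X
  choose f hf using hα
  set V := ⋃ i, U i
  let base : X → X := fun x => Classical.epsilon (· ∈ connectedComponentIn V x)
  have hbase : ∀ x ∈ V, ∃ i, x ∈ U i ∧ base x ∈ connectedComponentIn (U i) x := fun x hx =>
    exists_mem_connectedComponentIn_of_directed hU hdir
      (Classical.epsilon_spec ⟨x, mem_connectedComponentIn hx⟩)
  have hvalue : ∀ x : X, ∃ c : ℝ, ∀ i, x ∈ U i → base x ∈ connectedComponentIn (U i) x →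
      c = f i x - f i (base x) := by
    intro x
    by_cases hx : x ∈ V
    · obtain ⟨i, hxi, hbi⟩ := hbase x hx
      exact ⟨_, fun j hxj hbj => hp.sub_eq_sub_of_directed hU hdir hf hxi hbi hxj hbj⟩
    · exact ⟨0, fun i hxi => (hx (mem_iUnion_of_mem i hxi)).elim⟩
  choose F hF using hvalue
  refine ⟨F, fun x hx => ?_⟩
  obtain ⟨i, hxi, hbi⟩ := hbase x hx
  have heq : F =ᶠ[𝓝 x] fun y => f i y - f i (base x) := by
    filter_upwards [connectedComponentIn_mem_nhds ((hU i).mem_nhds hxi)] with y hy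
    have hby : base y = base x := by
      simp only [base, connectedComponentIn_eq (connectedComponentIn_mono x (subset_iUnion U i) hy),
        V]
    rw [← hby]
    refine hF y i (connectedComponentIn_subset _ _ hy) ?_
    rwa [hby, ← connectedComponentIn_eq hy]
  obtain ⟨hs, hα⟩ := hf _ x hxi
  have hs' := hs.sub (contMDiffAt_const (c := f i (base x)))
  refine ⟨hs'.congr_of_eventuallyEq heq, ?_⟩
  rw [hα, extDer, extDer, heq.mfderiv_eq]
  have h := (hs.mdifferentiableAt (by simp)).hasMFDerivAt.sub
    (hasMFDerivAt_const (f i (base x)) x)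
  exact ((sub_zero _).symm.trans h.mfderiv.symm)

end HasTranslationCharts

/-! ### Absolutely continuous paths in the plane and integrals along them -/

section Paths

theorem integral_circle_eq {E : Type*} [NormedAddCommGroup E] [NormedSpace ℝ E]
    (g : UnitAddCircle → E) :
    ∫ s, g s = ∫ s : unitInterval, g ((s : ℝ) : UnitAddCircle) := by
  have hcircle := AddCircle.intervalIntegral_preimage (1 : ℝ) 0 g
  rw [zero_add] at hcircle
  have hsubtype := integral_subtype (measurableSet_Icc (a := (0 : ℝ)) (b := 1))
    (fun r : ℝ => g (r : UnitAddCircle))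
  rw [integral_Icc_eq_integral_Ioc, ← intervalIntegral.integral_of_le zero_le_one, hcircle]
    at hsubtype
  exact hsubtype.symm

theorem integral_unitInterval_eq {E : Type*} [NormedAddCommGroup E] [NormedSpace ℝ E]
    (g : ℝ → E) : ∫ s : unitInterval, g s = ∫ s in (0 : ℝ)..1, g s := by
  have hsubtype := integral_subtype (measurableSet_Icc (a := (0 : ℝ)) (b := 1)) g
  rw [integral_Icc_eq_integral_Ioc, ← intervalIntegral.integral_of_le zero_le_one] at hsubtype
  exact hsubtype

theorem measurePreserving_unitInterval :
    MeasurePreserving (fun s : unitInterval => ((s : ℝ) : UnitAddCircle)) volume volume := by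
  have h := AddCircle.measurePreserving_mk (1 : ℝ) 0
  rw [zero_add, Measure.restrict_congr_set (Ioc_ae_eq_Icc (a := (0 : ℝ)) (b := 1))] at h
  exact h.comp unitInterval.measurePreserving_coe

/-- Restriction of a square-integrable function on the circle to the unit interval. -/
def restrictL : L2 →L[ℝ] Lp Plane 2 (volume : Measure unitInterval) :=
  (Lp.compMeasurePreservingₗᵢ ℝ _ measurePreserving_unitInterval).toContinuousLinearMap

theorem coeFn_restrictL (u : L2) :
    restrictL u =ᵐ[volume] fun s : unitInterval => u ((s : ℝ) : UnitAddCircle) :=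
  Lp.coeFn_compMeasurePreserving u measurePreserving_unitInterval

instance isProbabilityMeasure_circle : IsProbabilityMeasure (volume : Measure UnitAddCircle) :=
  ⟨UnitAddCircle.measure_univ⟩

theorem integral_norm_L2_le (u : L2) : ∫ s, ‖u s‖ ≤ ‖u‖ := by
  rw [integral_norm_eq_lintegral_enorm (integrable_L2 u).aestronglyMeasurable,
    ← eLpNorm_one_eq_lintegral_enorm, Lp.norm_def]
  exact ENNReal.toReal_mono (Lp.eLpNorm_ne_top u)
    (eLpNorm_le_eLpNorm_of_exponent_le (by norm_num) (integrable_L2 u).aestronglyMeasurable)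

theorem integral_norm_interval (u : L2) : ∫ r in (0 : ℝ)..1, ‖u (r : UnitAddCircle)‖ ≤ ‖u‖ := by
  have hcircle := AddCircle.intervalIntegral_preimage (1 : ℝ) 0 (fun s => ‖u s‖)
  rw [zero_add] at hcircle
  rw [hcircle]
  exact integral_norm_L2_le u

theorem norm_prim_le (u : L2) {s : ℝ} (hs : s ∈ Icc (0 : ℝ) 1) : ‖prim u s‖ ≤ ‖u‖ := by
  refine (intervalIntegral.norm_integral_le_integral_norm hs.1).trans
    (le_trans ?_ (integral_norm_interval u))
  exact intervalIntegral.integral_mono_interval le_rfl hs.1 hs.2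
    (Filter.Eventually.of_forall fun _ => norm_nonneg _)
    (intervalIntegrable_of_integrable (integrable_L2 u)).norm

/-- An absolutely continuous path in the plane, given by its initial point and its velocity. -/
abbrev PathData : Type := Plane × L2

/-- The path with given initial point and velocity. -/
def path : PathData →L[ℝ] C(unitInterval, Plane) :=
  LinearMap.mkContinuous
    { toFun := fun w => ⟨fun s => w.1 + prim w.2 s, continuous_const.add
        (continuousOn_iff_continuous_domRestrict.1 (continuousOn_prim w.2))⟩
      map_add' := fun w w' => by
        ext1 s
        change w.1 + w'.1 + prim (w.2 + w'.2) s = w.1 + prim w.2 s + (w'.1 + prim w'.2 s)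
        rw [prim_add _ _ s.2]
        abel
      map_smul' := fun c w => by
        ext1 s
        change c • w.1 + prim (c • w.2) s = c • (w.1 + prim w.2 s)
        rw [prim_smul _ _ s.2, smul_add] } 2 (by
    intro w
    refine (ContinuousMap.norm_le _ (by positivity)).2 fun s => ?_
    refine (norm_add_le _ _).trans ?_
    linarith [norm_fst_le w, (norm_prim_le w.2 s.2).trans (norm_snd_le w)])

theorem path_apply (w : PathData) (s : unitInterval) : path w s = w.1 + prim w.2 s := rfl

@[simp] theorem prim_at_zero (u : L2) : prim u 0 = 0 := intervalIntegral.integral_same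

theorem path_add_const (w : PathData) (p : Plane) (s : unitInterval) :
    path (w + (p, 0)) s = path w s + p := by
  rw [map_add, ContinuousMap.add_apply, path_apply (_, 0), prim_zero s.2, add_zero]

@[simp] theorem path_zero (w : PathData) : path w 0 = w.1 := by
  simp [path_apply]

theorem path_one (w : PathData) : path w 1 = w.1 + prim w.2 1 := by
  simp [path_apply]

/-- The pairing `∫₀¹ Θ(s) u(s) ds`. -/
def pairing : C(unitInterval, Plane →L[ℝ] ℝ) →L[ℝ] L2 →L[ℝ] ℝ :=
  (((ContinuousLinearMap.id ℝ (Plane →L[ℝ] ℝ)).lpPairing (volume : Measure unitInterval) 2 2).comp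
    (ContinuousMap.toLp (E := Plane →L[ℝ] ℝ) 2 (volume : Measure unitInterval) ℝ)).bilinearComp
      (ContinuousLinearMap.id ℝ _) restrictL

theorem pairing_apply (Θ : C(unitInterval, Plane →L[ℝ] ℝ)) (u : L2) :
    pairing Θ u = ∫ s : unitInterval, Θ s (u ((s : ℝ) : UnitAddCircle)) := by
  change (ContinuousLinearMap.id ℝ (Plane →L[ℝ] ℝ)).lpPairing (volume : Measure unitInterval) 2 2
    (ContinuousMap.toLp (E := Plane →L[ℝ] ℝ) 2 (volume : Measure unitInterval) ℝ Θ)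
    (restrictL u) = _
  rw [ContinuousLinearMap.lpPairing_eq_integral]
  refine integral_congr_ae ?_
  filter_upwards [coeFn_restrictL u,
    ContinuousMap.coeFn_toLp (p := 2) (𝕜 := ℝ) (volume : Measure unitInterval) Θ] with s h1 h2
  rw [h1, h2]
  rfl

/-- The pairing `∫₀¹ G(s)(u(s), v(s)) ds`. -/
def pairing₂ : C(unitInterval, Plane →L[ℝ] Plane →L[ℝ] ℝ) →L[ℝ] L2 →L[ℝ] L2 →L[ℝ] ℝ :=
  ((((ContinuousLinearMap.id ℝ (Plane →L[ℝ] ℝ)).lpPairing (volume : Measure unitInterval) 2 2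
    ).bilinearComp (ContinuousLinearMap.id ℝ _) restrictL).postcomp L2).comp
    ((((ContinuousLinearMap.id ℝ (Plane →L[ℝ] Plane →L[ℝ] ℝ)).holderL
      (volume : Measure unitInterval) ⊤ 2 2).comp
      (ContinuousMap.toLp (E := Plane →L[ℝ] Plane →L[ℝ] ℝ) ⊤ (volume : Measure unitInterval) ℝ)
      ).bilinearComp (ContinuousLinearMap.id ℝ _) restrictL)

theorem pairing₂_apply (G : C(unitInterval, Plane →L[ℝ] Plane →L[ℝ] ℝ)) (u v : L2) :
    pairing₂ G u v = ∫ s : unitInterval,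
      G s (u ((s : ℝ) : UnitAddCircle)) (v ((s : ℝ) : UnitAddCircle)) := by
  change (ContinuousLinearMap.id ℝ (Plane →L[ℝ] ℝ)).lpPairing (volume : Measure unitInterval) 2 2
    ((ContinuousLinearMap.id ℝ (Plane →L[ℝ] Plane →L[ℝ] ℝ)).holder 2
      (ContinuousMap.toLp (E := Plane →L[ℝ] Plane →L[ℝ] ℝ) ⊤ (volume : Measure unitInterval) ℝ G)
      (restrictL u)) (restrictL v) = _
  rw [ContinuousLinearMap.lpPairing_eq_integral]
  refine integral_congr_ae ?_
  filter_upwards [coeFn_restrictL u, coeFn_restrictL v,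
    ContinuousMap.coeFn_toLp (p := ⊤) (𝕜 := ℝ) (volume : Measure unitInterval) G,
    (ContinuousLinearMap.id ℝ (Plane →L[ℝ] Plane →L[ℝ] ℝ)).coeFn_holder (r := 2)
      (ContinuousMap.toLp (E := Plane →L[ℝ] Plane →L[ℝ] ℝ) ⊤ (volume : Measure unitInterval) ℝ G)
      (restrictL u)] with s h1 h2 h3 h4
  rw [h2, h4, h1, h3]
  rfl

theorem path_toLp (p : Plane) (u : C(UnitAddCircle, Plane)) (s : unitInterval) :
    path (p, ContinuousMap.toLp 2 volume ℝ u) s =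
      p + ∫ r in (0 : ℝ)..s, u (r : UnitAddCircle) := by
  rw [path_apply]
  exact congrArg (p + ·) (integral_congr_L2 (ContinuousMap.coeFn_toLp volume u) s.2)

theorem pairing_toLp {Θ : C(unitInterval, Plane →L[ℝ] ℝ)} {θ : ℝ → Plane →L[ℝ] ℝ}
    (h : ∀ s : unitInterval, Θ s = θ s) (u : C(UnitAddCircle, Plane)) :
    pairing Θ (ContinuousMap.toLp 2 volume ℝ u) =
      ∫ s in (0 : ℝ)..1, θ s (u (s : UnitAddCircle)) := by
  rw [pairing_apply, ← integral_unitInterval_eq]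
  refine integral_congr_ae ?_
  filter_upwards [measurePreserving_unitInterval.quasiMeasurePreserving.ae_eq_comp
    (ContinuousMap.coeFn_toLp (p := 2) (𝕜 := ℝ) (volume : Measure UnitAddCircle) u)] with s hs
  rw [h]
  exact congrArg (θ s) hs

theorem hasDerivAt_const_add_integral (p : Plane) (u : C(UnitAddCircle, Plane)) (s : ℝ) :
    HasDerivAt (fun s : ℝ => p + ∫ r in (0 : ℝ)..s, u (r : UnitAddCircle))
      (u (s : UnitAddCircle)) s :=
  ((u.continuous.comp isLocalHomeomorph_coe_circle.continuous).integral_hasStrictDerivAt 0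
    s).hasDerivAt.const_add p

theorem denseRange_toLp_pathData :
    DenseRange (Prod.map id (ContinuousMap.toLp 2 volume ℝ) :
      Plane × C(UnitAddCircle, Plane) → PathData) :=
  denseRange_id.prodMap (ContinuousMap.toLp_denseRange Plane volume ℝ (by norm_num))

section IntegrationByParts

variable {θ : C(Plane, Plane →L[ℝ] ℝ)} {θ' : C(Plane, Plane →L[ℝ] Plane →L[ℝ] ℝ)}

theorem pairing_add_pairing_flip_toLp (hθ : ∀ v, HasFDerivAt θ (θ' v).flip v) (p q : Plane)
    (u v : C(UnitAddCircle, Plane)) {w w' : PathData}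
    (hw : w = (p, ContinuousMap.toLp 2 volume ℝ u))
    (hw' : w' = (q, ContinuousMap.toLp 2 volume ℝ v)) :
    pairing (superpose θ (path w)) w'.2 +
        pairing (applyL _ _ _ (superpose θ' (path w)) (path w')) w.2 =
      θ (path w 1) (path w' 1) - θ (path w 0) (path w' 0) := by
  subst hw hw'
  let c : ℝ → Plane := fun s => p + ∫ r in (0 : ℝ)..s, u (r : UnitAddCircle)
  let d : ℝ → Plane := fun s => q + ∫ r in (0 : ℝ)..s, v (r : UnitAddCircle)
  have hc : ∀ s : unitInterval, path (p, ContinuousMap.toLp 2 volume ℝ u) s = c s :=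
    path_toLp p u
  have hd : ∀ s : unitInterval, path (q, ContinuousMap.toLp 2 volume ℝ v) s = d s :=
    path_toLp q v
  have hderiv : ∀ s, HasDerivAt (fun s => θ (c s) (d s)) (θ (c s) (v (s : UnitAddCircle)) +
      θ' (c s) (d s) (u (s : UnitAddCircle))) s := fun s => by
    rw [add_comm]
    exact ((hθ (c s)).comp_hasDerivAt s (hasDerivAt_const_add_integral p u s)).clm_apply
      (hasDerivAt_const_add_integral q v s)
  have hc_cont : Continuous c :=
    continuous_iff_continuousAt.2 fun s => (hasDerivAt_const_add_integral p u s).continuousAt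
  have hd_cont : Continuous d :=
    continuous_iff_continuousAt.2 fun s => (hasDerivAt_const_add_integral q v s).continuousAt
  have hcoe : Continuous fun s : ℝ => (s : UnitAddCircle) :=
    isLocalHomeomorph_coe_circle.continuous
  have h₁ : Continuous fun s : ℝ => θ (c s) (v (s : UnitAddCircle)) :=
    (θ.continuous.comp hc_cont).clm_apply (v.continuous.comp hcoe)
  have h₂ : Continuous fun s : ℝ => θ' (c s) (d s) (u (s : UnitAddCircle)) :=
    ((θ'.continuous.comp hc_cont).clm_apply hd_cont).clm_apply (u.continuous.comp hcoe)
  have hftc := intervalIntegral.integral_eq_sub_of_hasDerivAt (fun s _ => hderiv s)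
    ((h₁.add h₂).intervalIntegrable 0 1)
  rw [intervalIntegral.integral_add (h₁.intervalIntegrable _ _) (h₂.intervalIntegrable _ _)] at hftc
  rw [pairing_toLp (θ := fun s => θ (c s)) (fun s => congrArg θ (hc s)),
    pairing_toLp (θ := fun s => θ' (c s) (d s))
      (fun s => congrArg₂ (fun x y => θ' x y) (hc s) (hd s)), hftc, hc, hc, hd, hd]
  simp

/- Both sides are continuous in the two paths, so continuous velocities suffice. -/
theorem pairing_add_pairing_flip (hθ : ∀ v, HasFDerivAt θ (θ' v).flip v) (w w' : PathData) :
    pairing (superpose θ (path w)) w'.2 +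
        pairing (applyL _ _ _ (superpose θ' (path w)) (path w')) w.2 =
      θ (path w 1) (path w' 1) - θ (path w 0) (path w' 0) := by
  have heval : ∀ s, Continuous fun w : PathData => path w s := fun s =>
    (ContinuousEvalConst.continuous_eval_const s).comp path.continuous
  have hleft : Continuous fun z : PathData × PathData =>
      pairing (superpose θ (path z.1)) z.2.2 +
        pairing (applyL _ _ _ (superpose θ' (path z.1)) (path z.2)) z.1.2 := by
    have h₁ : Continuous fun z : PathData × PathData => superpose θ (path z.1) :=
      θ.continuous_postcomp.comp (path.continuous.comp continuous_fst)
    have h₂ : Continuous fun z : PathData × PathData => superpose θ' (path z.1) :=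
      θ'.continuous_postcomp.comp (path.continuous.comp continuous_fst)
    exact ((pairing.continuous.comp h₁).clm_apply (by fun_prop)).add
      ((pairing.continuous.comp (((applyL _ _ _).continuous.comp h₂).clm_apply
        (path.continuous.comp continuous_snd))).clm_apply (by fun_prop))
  have hright : Continuous fun z : PathData × PathData =>
      θ (path z.1 1) (path z.2 1) - θ (path z.1 0) (path z.2 0) := by
    have := heval 0
    have := heval 1
    have := θ.continuous
    fun_prop
  refine congrFun ((denseRange_toLp_pathData.prodMap denseRange_toLp_pathData).equalizer hleft
    hright ?_) (w, w')
  funext ⟨⟨p, u⟩, ⟨q, v⟩⟩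
  exact pairing_add_pairing_flip_toLp hθ p q u v rfl rfl

end IntegrationByParts

/-- The integral of a 1-form along an absolutely continuous path. -/
def lineInt (θ : C(Plane, Plane →L[ℝ] ℝ)) (w : PathData) : ℝ :=
  pairing (superpose θ (path w)) w.2

theorem contDiff_lineInt {θ : C(Plane, Plane →L[ℝ] ℝ)} (hθ : ContDiff ℝ ∞ θ) :
    ContDiff ℝ ∞ (lineInt θ) := by
  have hpath : ContDiff ℝ ∞ fun w : PathData => superpose θ (path w) :=
    (contDiff_superpose θ hθ).comp path.contDiff
  have hpairing : ContDiff ℝ ∞ pairing := ContinuousLinearMap.contDiff (𝕜 := ℝ)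
    (E := C(unitInterval, Plane →L[ℝ] ℝ)) (F := L2 →L[ℝ] ℝ) pairing
  exact (hpairing.comp hpath).clm_apply contDiff_snd

theorem hasFDerivAt_lineInt {θ : C(Plane, Plane →L[ℝ] ℝ)}
    {θ' : C(Plane, Plane →L[ℝ] Plane →L[ℝ] ℝ)} (hθ : ∀ v, HasFDerivAt θ (θ' v) v)
    (w : PathData) :
    HasFDerivAt (lineInt θ) ((pairing (superpose θ (path w))).comp (.snd ℝ Plane L2) +
      ((pairing.comp ((applyL _ _ _ (superpose θ' (path w))).comp path)).flip w.2)) w := by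
  have hsuperpose : HasFDerivAt (fun w : PathData => superpose θ (path w))
      ((applyL unitInterval Plane (Plane →L[ℝ] ℝ) (superpose θ' (path w))).comp path) w :=
    (hasFDerivAt_superpose θ θ' hθ (path w)).comp w path.hasFDerivAt
  exact (pairing.hasFDerivAt.comp w hsuperpose).clm_apply (hasFDerivAt_snd (𝕜 := ℝ) (p := w))

/- Integration by parts exchanges the derivative of the variation for the exterior derivative of
`θ`, up to boundary terms. -/
theorem fderiv_lineInt_apply {θ : C(Plane, Plane →L[ℝ] ℝ)} (hθ : ContDiff ℝ ∞ θ)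
    (w w' : PathData) :
    fderiv ℝ (lineInt θ) w w' =
      (∫ s : unitInterval,
        (fderiv ℝ θ (path w s) (path w' s) (w.2 ((s : ℝ) : UnitAddCircle)) -
          fderiv ℝ θ (path w s) (w.2 ((s : ℝ) : UnitAddCircle)) (path w' s))) +
      (θ (path w 1) (path w' 1) - θ (path w 0) (path w' 0)) := by
  have hcont : Continuous (fderiv ℝ θ) := hθ.continuous_fderiv (by simp)
  have hderiv : ∀ v, HasFDerivAt θ (fderiv ℝ θ v) v := fun v =>
    (hθ.differentiable (by simp) v).hasFDerivAt
  let θ' : C(Plane, Plane →L[ℝ] Plane →L[ℝ] ℝ) := ⟨fderiv ℝ θ, hcont⟩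
  let θflip : C(Plane, Plane →L[ℝ] Plane →L[ℝ] ℝ) := ⟨fun v => (fderiv ℝ θ v).flip,
    (ContinuousLinearMap.flipₗᵢ ℝ Plane Plane ℝ).continuous.comp hcont⟩
  have hparts := pairing_add_pairing_flip (θ' := θflip) hderiv w w'
  have hext : pairing (applyL _ _ _ (superpose θ' (path w)) (path w') -
      applyL _ _ _ (superpose θflip (path w)) (path w')) w.2 = _ := pairing_apply _ _
  rw [map_sub, sub_apply] at hext
  refine (congrArg (· w') (hasFDerivAt_lineInt (θ' := θ') hderiv w).fderiv).trans ?_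
  refine Eq.trans ?_ (congrArg₂ (· + ·) hext hparts)
  simp only [add_apply, ContinuousLinearMap.comp_apply,
    ContinuousLinearMap.flip_apply, ContinuousLinearMap.coe_snd']
  ring

end Paths

/-! ### Potentials of 2-forms on the torus -/

section Lattice

theorem coe_eq_coe_iff_exists_int (x y : ℝ) :
    (x : UnitAddCircle) = (y : UnitAddCircle) ↔ ∃ n : ℤ, x = y + n := by
  rw [← sub_eq_zero, ← AddCircle.coe_sub, AddCircle.coe_eq_zero_iff]
  refine exists_congr fun n => ?_
  rw [zsmul_eq_mul, mul_one, eq_sub_iff_add_eq', eq_comm]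

theorem proj_eq_proj_iff (v w : Plane) :
    proj v = proj w ↔ ∃ m n : ℤ, v = w + ((m : ℝ), (n : ℝ)) := by
  refine Prod.ext_iff.trans ?_
  refine (and_congr (coe_eq_coe_iff_exists_int _ _) (coe_eq_coe_iff_exists_int _ _)).trans ?_
  simp [Prod.ext_iff]

theorem proj_surjective : Function.Surjective proj :=
  Function.Surjective.prodMap QuotientAddGroup.mk_surjective QuotientAddGroup.mk_surjective

/-- Invariance under translations by `ℤ²`. -/
def LatticePeriodic {F : Type*} (h : Plane → F) : Prop :=
  ∀ (v : Plane) (m n : ℤ), h (v + ((m : ℝ), (n : ℝ))) = h v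

theorem latticePeriodic_comp_proj {F : Type*} (f : Torus → F) :
    LatticePeriodic fun v => f (proj v) := fun _ m n =>
  congrArg f ((proj_eq_proj_iff _ _).2 ⟨m, n, rfl⟩)

end Lattice

section Primitives

/-- Integration over the unit interval. -/
def integralC : C(unitInterval, ℝ) →L[ℝ] ℝ :=
  (L1.integralCLM' ℝ).comp (ContinuousMap.toLp 1 (volume : Measure unitInterval) ℝ)

theorem integralC_apply (f : C(unitInterval, ℝ)) : integralC f = ∫ s, f s := by
  change L1.integralCLM _ = _
  rw [← L1.integral_eq, L1.integral_eq_integral]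
  exact integral_congr_ae (ContinuousMap.coeFn_toLp _ f)

/-- The horizontal segment `s ↦ (s x, y)`. -/
def segmentL : Plane →L[ℝ] C(unitInterval, Plane) :=
  LinearMap.toContinuousLinearMap
    { toFun := fun v => ⟨fun s => (v.1 * s, v.2), by fun_prop⟩
      map_add' := fun v w => by ext s <;> simp [add_mul]
      map_smul' := fun c v => by ext s <;> simp [mul_assoc] }

/-- The primitive `∫₀ˣ h(r, y) dr` in the first variable. -/
def xPrim (h : Plane → ℝ) (v : Plane) : ℝ := ∫ r in (0 : ℝ)..v.1, h (r, v.2)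

variable {h : Plane → ℝ}

theorem contDiff_xPrim (hh : ContDiff ℝ ∞ h) : ContDiff ℝ ∞ (xPrim h) := by
  let H : C(Plane, ℝ) := ⟨h, hh.continuous⟩
  have hscale : xPrim h = fun v => v.1 * integralC (superpose H (segmentL v)) := by
    funext v
    have hsub := intervalIntegral.smul_integral_comp_mul_left (a := 0) (b := 1)
      (fun r : ℝ => h (r, v.2)) v.1
    rw [mul_zero, mul_one, smul_eq_mul] at hsub
    rw [xPrim, ← hsub, integralC_apply]
    exact congrArg (v.1 * ·) (integral_unitInterval_eq fun s => h (v.1 * s, v.2)).symm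
  rw [hscale]
  exact contDiff_fst.mul
    (integralC.contDiff.comp ((contDiff_superpose H hh).comp segmentL.contDiff))

theorem fderiv_xPrim (hh : ContDiff ℝ ∞ h) (v : Plane) : fderiv ℝ (xPrim h) v (1, 0) = h v := by
  have hpartial : HasDerivAt (fun x => xPrim h (x, v.2)) (fderiv ℝ (xPrim h) v (1, 0)) v.1 :=
    HasFDerivAt.comp_hasDerivAt (f := fun x : ℝ => ((x, v.2) : Plane)) v.1
      ((contDiff_xPrim hh).differentiable (by simp) v).hasFDerivAt
      ((hasDerivAt_id v.1).prodMk (hasDerivAt_const v.1 v.2))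
  have hrow : Continuous fun r : ℝ => h (r, v.2) := hh.continuous.comp (by fun_prop)
  exact hpartial.unique (hrow.integral_hasStrictDerivAt 0 v.1).hasDerivAt

theorem latticePeriodic_xPrim (hper : LatticePeriodic h) (hh : Continuous h)
    (hmean : ∀ y, xPrim h (1, y) = 0) : LatticePeriodic (xPrim h) := by
  intro v m n
  have hrow : Continuous fun r : ℝ => h (r, v.2) := by fun_prop
  have hshift : ∀ r, h (r, v.2 + n) = h (r, v.2) := fun r => by simpa using hper (r, v.2) 0 n
  have hperiodic : Function.Periodic (fun r : ℝ => h (r, v.2)) 1 := fun r => by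
    simpa using hper (r, v.2) 1 0
  have hint : ∫ r in v.1..v.1 + m, h (r, v.2) = 0 := by
    have hz := hperiodic.intervalIntegral_add_zsmul_eq m v.1
      fun _ _ => hrow.intervalIntegrable _ _
    rw [hperiodic.intervalIntegral_add_eq v.1 0, zero_add] at hz
    have hrow0 : ∫ r in (0 : ℝ)..1, h (r, v.2) = 0 := hmean v.2
    simpa [hrow0] using hz
  simp only [xPrim, Prod.fst_add, Prod.snd_add, hshift]
  rw [← intervalIntegral.integral_add_adjacent_intervals (b := v.1)
    (hrow.intervalIntegrable _ _) (hrow.intervalIntegrable _ _), hint, add_zero]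

/- Subtract from `h` its row averages `m(y)`, and from these their average `c`: both remainders have
periodic primitives, in `x` and in `y` respectively. -/
theorem exists_periodic_primitives (hh : ContDiff ℝ ∞ h) (hper : LatticePeriodic h) :
    ∃ A B : Plane → ℝ, ContDiff ℝ ∞ A ∧ ContDiff ℝ ∞ B ∧ LatticePeriodic A ∧ LatticePeriodic B ∧
      ∀ v, fderiv ℝ B v (1, 0) - fderiv ℝ A v (0, 1) =
        h v - ∫ y in (0 : ℝ)..1, ∫ x in (0 : ℝ)..1, h (x, y) := by
  let m : ℝ → ℝ := fun y => xPrim h (1, y)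
  let c : ℝ := ∫ y in (0 : ℝ)..1, m y
  have hm : ContDiff ℝ ∞ m := (contDiff_xPrim hh).comp (contDiff_const.prodMk contDiff_id)
  have hm_per : ∀ (y : ℝ) (n : ℤ), m (y + n) = m y := fun y n =>
    intervalIntegral.integral_congr fun r _ => by simpa using hper (r, y) 0 n
  let g : Plane → ℝ := fun v => h v - m v.2
  let k : Plane → ℝ := fun v => c - m v.1
  have hg : ContDiff ℝ ∞ g := hh.sub (hm.comp contDiff_snd)
  have hk : ContDiff ℝ ∞ k := contDiff_const.sub (hm.comp contDiff_fst)
  have hg_per : LatticePeriodic g := fun v i j => congrArg₂ (· - ·) (hper v i j) (hm_per v.2 j)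
  have hk_per : LatticePeriodic k := fun v i j => congrArg (c - ·) (hm_per v.1 i)
  have hg_mean : ∀ y, xPrim g (1, y) = 0 := fun y => by
    have hrow : Continuous fun r : ℝ => h (r, y) := hh.continuous.comp (by fun_prop)
    change ∫ r in (0 : ℝ)..1, (h (r, y) - m y) = 0
    rw [intervalIntegral.integral_sub (hrow.intervalIntegrable _ _) (by simp)]
    simp [m, xPrim]
  have hk_mean : ∀ y, xPrim k (1, y) = 0 := fun y => by
    change ∫ r in (0 : ℝ)..1, (c - m r) = 0
    rw [intervalIntegral.integral_sub (by simp) (hm.continuous.intervalIntegrable _ _)]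
    simp [c]
  let swapL : Plane ≃L[ℝ] Plane := ContinuousLinearEquiv.prodComm ℝ ℝ ℝ
  refine ⟨xPrim k ∘ swapL, xPrim g, (contDiff_xPrim hk).comp swapL.contDiff, contDiff_xPrim hg,
    fun v i j => latticePeriodic_xPrim hk_per hk.continuous hk_mean v.swap j i,
    latticePeriodic_xPrim hg_per hg.continuous hg_mean, fun v => ?_⟩
  have hA : fderiv ℝ (xPrim k ∘ swapL) v (0, 1) = k v.swap := by
    rw [swapL.comp_right_fderiv]
    exact fderiv_xPrim hk v.swap
  rw [fderiv_xPrim hg, hA]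
  change h v - m v.2 - (c - m v.2) = h v - c
  ring

end Primitives

section Potentials

theorem areaForm_apply (q : Torus) (v w : Plane) :
    areaForm.toFun q v w = v.1 * w.2 - v.2 * w.1 := rfl

theorem TwoForm.apply_eq (σ : TwoForm) (q : Torus) (v w : Plane) :
    σ.toFun q v w = σ.toFun q (1, 0) (0, 1) * areaForm.toFun q v w := by
  have hskew : σ.toFun q (0, 1) (1, 0) = -σ.toFun q (1, 0) (0, 1) := by
    have h := σ.alt q ((1, 0) + (0, 1))
    simp only [map_add, add_apply, σ.alt] at h
    linarith
  have hbasis : ∀ a : Plane, a = a.1 • ((1, 0) : Plane) + a.2 • ((0, 1) : Plane) := fun a => by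
    ext <;> simp
  rw [areaForm_apply, hbasis v, hbasis w]
  simp only [map_add, map_smul, add_apply, smul_apply, σ.alt, hskew, smul_eq_mul]
  simp
  ring

theorem TwoForm.contDiff_comp_proj (σ : TwoForm) : ContDiff ℝ ∞ fun v => σ.toFun (proj v) :=
  (hasTranslationCharts_proj.contMDiff_iff proj_surjective).1 σ.smooth

theorem integral_torus_eq {f : Torus → ℝ} (hf : Continuous f) :
    ∫ q, f q = ∫ y in (0 : ℝ)..1, ∫ x in (0 : ℝ)..1, f (proj (x, y)) := by
  have hcircle : ∀ g : UnitAddCircle → ℝ, ∫ s, g s = ∫ r in (0 : ℝ)..1, g (r : UnitAddCircle) :=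
    fun g => (integral_circle_eq g).trans (integral_unitInterval_eq fun r => g r)
  have hint : Integrable f ((volume : Measure UnitAddCircle).prod volume) :=
    hf.integrable_of_hasCompactSupport (HasCompactSupport.of_compactSpace _)
  refine (integral_prod_symm f hint).trans ?_
  simp only [hcircle]
  rfl

theorem fderiv_sub_fderiv_of_components {A B : Plane → ℝ} {v : Plane}
    (hA : DifferentiableAt ℝ A v) (hB : DifferentiableAt ℝ B v) (a b : Plane) :
    fderiv ℝ (fun v => A v • ContinuousLinearMap.fst ℝ ℝ ℝ + B v • .snd ℝ ℝ ℝ) v a b -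
        fderiv ℝ (fun v => A v • ContinuousLinearMap.fst ℝ ℝ ℝ + B v • .snd ℝ ℝ ℝ) v b a =
      (fderiv ℝ B v (1, 0) - fderiv ℝ A v (0, 1)) * (a.1 * b.2 - a.2 * b.1) := by
  have hbasis : ∀ (L : Plane →L[ℝ] ℝ) (a : Plane), L a = a.1 * L (1, 0) + a.2 * L (0, 1) :=
    fun L a => by
      conv_lhs => rw [show a = a.1 • ((1, 0) : Plane) + a.2 • ((0, 1) : Plane) by ext <;> simp]
      simp only [map_add, map_smul, smul_eq_mul]
  have hderiv : HasFDerivAt (fun v => A v • ContinuousLinearMap.fst ℝ ℝ ℝ + B v • .snd ℝ ℝ ℝ) _ v :=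
    (hA.hasFDerivAt.smul_const _).add (hB.hasFDerivAt.smul_const _)
  rw [hderiv.fderiv]
  simp only [add_apply, ContinuousLinearMap.smulRight_apply, smul_apply, smul_eq_mul,
    ContinuousLinearMap.coe_fst', ContinuousLinearMap.coe_snd']
  rw [hbasis (fderiv ℝ A v) a, hbasis (fderiv ℝ A v) b, hbasis (fderiv ℝ B v) a,
    hbasis (fderiv ℝ B v) b]
  ring

/-- The 1-form `θ` on the plane is a potential of `σ - c dq¹ ∧ dq²`, lifted to the plane. -/
structure IsPotential (σ : TwoForm) (c : ℝ) (θ : C(Plane, Plane →L[ℝ] ℝ)) : Prop where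
  smooth : ContDiff ℝ ∞ θ
  fderiv_sub : ∀ v a b : Plane, fderiv ℝ θ v a b - fderiv ℝ θ v b a =
    σ.toFun (proj v) a b - c * areaForm.toFun (proj v) a b

theorem TwoForm.exists_isPotential (σ : TwoForm) :
    ∃ θ, IsPotential σ σ.integral θ ∧ LatticePeriodic θ := by
  have hh : ContDiff ℝ ∞ fun v => σ.toFun (proj v) (1, 0) (0, 1) :=
    (σ.contDiff_comp_proj.clm_apply contDiff_const).clm_apply contDiff_const
  obtain ⟨A, B, hA, hB, hA_per, hB_per, hAB⟩ := exists_periodic_primitives hh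
    (latticePeriodic_comp_proj fun q => σ.toFun q (1, 0) (0, 1))
  have hθ : ContDiff ℝ ∞ fun v => A v • ContinuousLinearMap.fst ℝ ℝ ℝ + B v • .snd ℝ ℝ ℝ :=
    (hA.smul contDiff_const).add (hB.smul contDiff_const)
  let θ : C(Plane, Plane →L[ℝ] ℝ) := ⟨_, hθ.continuous⟩
  have hcoeff : ∀ v, σ.toFun (proj v) (1, 0) (0, 1) - σ.integral =
      fderiv ℝ B v (1, 0) - fderiv ℝ A v (0, 1) := fun v => by
    rw [hAB, TwoForm.integral, integral_torus_eq
      ((σ.smooth.continuous.clm_apply continuous_const).clm_apply continuous_const)]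
  refine ⟨θ, ⟨hθ, fun v a b => ?_⟩, fun v m n => ?_⟩
  swap
  · simp only [θ, ContinuousMap.coe_mk, hA_per v m n, hB_per v m n]
  rw [σ.apply_eq, ← sub_mul, hcoeff, areaForm_apply]
  exact fderiv_sub_fderiv_of_components (hA.differentiable (by simp) v)
    (hB.differentiable (by simp) v) a b

end Potentials

/-! ### Lifts of loops and transgression -/

section Lifts

/-- The path `w` in the plane is a lift of the loop `γ`, parametrised by `[0, 1]`. -/
def IsLift (γ : Loop) (w : PathData) : Prop := proj w.1 = Loop.pt γ 0 ∧ w.2 = γ.1.1.2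

theorem exists_isLift (γ : Loop) : ∃ w, IsLift γ w := by
  obtain ⟨p, hp⟩ := proj_surjective (Loop.pt γ 0)
  exact ⟨(p, γ.1.1.2), hp, rfl⟩

/-- A lift of a loop. -/
def chosenLift (γ : Loop) : PathData := (exists_isLift γ).choose

theorem isLift_chosenLift (γ : Loop) : IsLift γ (chosenLift γ) := (exists_isLift γ).choose_spec

theorem coe_one_eq_coe_zero :
    (((1 : unitInterval) : ℝ) : UnitAddCircle) = (((0 : unitInterval) : ℝ) : UnitAddCircle) :=
  (coe_eq_coe_iff_exists_int _ _).2 ⟨1, by simp⟩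

namespace IsLift

variable {γ : Loop} {w : PathData}

theorem proj_path (h : IsLift γ w) (s : unitInterval) :
    proj (path w s) = Loop.pt γ ((s : ℝ) : UnitAddCircle) := by
  rw [path_apply, map_add, h.1, h.2]
  exact (γ.1.2 s s.2).symm

theorem vel_eq (h : IsLift γ w) (s : UnitAddCircle) : Loop.vel γ s = w.2 s := by
  rw [h.2]
  rfl

theorem exists_prim_eq (h : IsLift γ w) : ∃ a b : ℤ, prim w.2 1 = ((a : ℝ), (b : ℝ)) := by
  have hends : proj (path w 1) = proj (path w 0) := by
    rw [h.proj_path, h.proj_path, coe_one_eq_coe_zero]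
  obtain ⟨a, b, hab⟩ := (proj_eq_proj_iff _ _).1 hends
  rw [path_one, path_zero] at hab
  exact ⟨a, b, add_left_cancel hab⟩

theorem exists_eq_add {w' : PathData} (h : IsLift γ w) (h' : IsLift γ w') :
    ∃ m n : ℤ, w' = w + (((m : ℝ), (n : ℝ)), 0) := by
  obtain ⟨m, n, hmn⟩ := (proj_eq_proj_iff _ _).1 (h'.1.trans h.1.symm)
  exact ⟨m, n, Prod.ext hmn (h'.2.trans (h.2.symm.trans (add_zero _).symm))⟩

end IsLift

/-- The initial value and the velocity of a variation field along a loop. -/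
def liftL : LoopVec →L[ℝ] PathData :=
  ((((ContinuousMap.evalCLM ℝ (0 : UnitAddCircle)).comp
    (ContinuousLinearMap.fst ℝ C(UnitAddCircle, Plane) L2)).prod
    (ContinuousLinearMap.snd ℝ C(UnitAddCircle, Plane) L2)).comp H1.subtypeL).comp
    (ContinuousLinearMap.fst ℝ H1 ℝ)

theorem path_liftL (ζ : LoopVec) (s : unitInterval) :
    path (liftL ζ) s = LoopVec.field ζ ((s : ℝ) : UnitAddCircle) :=
  (ζ.1.2 s s.2).symm

theorem prim_liftL (ζ : LoopVec) : prim (liftL ζ).2 1 = 0 := by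
  have hends : path (liftL ζ) 1 = path (liftL ζ) 0 := by
    rw [path_liftL, path_liftL, coe_one_eq_coe_zero]
  simpa [path_one] using hends

theorem IsLift.add {γ : Loop} {w : PathData} (h : IsLift γ w) (ζ : LoopVec) :
    IsLift (γ + freeExp ζ) (w + liftL ζ) := by
  refine ⟨?_, congrArg (· + ζ.1.1.2) h.2⟩
  change proj (w.1 + ζ.1.1.1 0) = Loop.pt γ 0 + proj (ζ.1.1.1 0)
  rw [map_add, h.1]

theorem isPrimitiveMod_comp_chosenLift {P : ℝ} {f : PathData → ℝ} {α : OneForm LoopVec Loop}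
    {U : Set Loop} (hf : ContDiff ℝ ∞ f)
    (hα : ∀ γ w, IsLift γ w → ∀ ζ, α γ ζ = fderiv ℝ f w (liftL ζ))
    (hP : ∀ γ ∈ U, ∀ w, IsLift γ w → ∀ ζ (m n : ℤ),
      (f (w + liftL ζ + (((m : ℝ), (n : ℝ)), 0)) : AddCircle P) = f (w + liftL ζ)) :
    IsPrimitiveMod P (fun γ => f (chosenLift γ)) α U := by
  refine hasTranslationCharts_freeExp.isPrimitiveMod fun γ hγ =>
    ⟨fun ζ => f (chosenLift γ + liftL ζ),
      hf.comp (contDiff_const.add liftL.contDiff), .of_forall fun ζ => ⟨?_, ?_⟩⟩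
  · have hderiv : HasFDerivAt (fun ζ => f (chosenLift γ + liftL ζ)) _ ζ :=
      ((hf.differentiable (by simp) _).hasFDerivAt).comp ζ (liftL.hasFDerivAt.const_add _)
    rw [hderiv.fderiv]
    exact ContinuousLinearMap.ext (hα _ _ ((isLift_chosenLift γ).add ζ))
  · obtain ⟨m, n, hmn⟩ :=
      ((isLift_chosenLift γ).add ζ).exists_eq_add (isLift_chosenLift (γ + freeExp ζ))
    rw [hmn]
    exact (hP γ hγ _ (isLift_chosenLift γ) ζ m n).symm

theorem IsPotential.fderiv_lineInt_liftL {σ : TwoForm} {c : ℝ} {θ : C(Plane, Plane →L[ℝ] ℝ)}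
    (hθ : IsPotential σ c θ) {γ : Loop} {w : PathData} (h : IsLift γ w) (ζ : LoopVec) :
    fderiv ℝ (lineInt θ) w (liftL ζ) = transgression σ γ ζ - c * tau γ ζ +
      (θ (w.1 + prim w.2 1) (liftL ζ).1 - θ w.1 (liftL ζ).1) := by
  have hend : path (liftL ζ) 1 = (liftL ζ).1 := by rw [path_one, prim_liftL, add_zero]
  rw [fderiv_lineInt_apply hθ.smooth, hend, path_zero, path_one, path_zero]
  congr 1
  have htransgression : transgression σ γ ζ - c * tau γ ζ =
      ∫ s : UnitAddCircle, (σ.toFun (Loop.pt γ s) (LoopVec.field ζ s) (Loop.vel γ s) -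
        c * areaForm.toFun (Loop.pt γ s) (LoopVec.field ζ s) (Loop.vel γ s)) := by
    rw [integral_sub (integrable_transgression σ γ ζ)
      ((integrable_transgression areaForm γ ζ).const_mul c), integral_const_mul]
    rfl
  rw [htransgression, integral_circle_eq]
  simp only [← h.proj_path, h.vel_eq, ← path_liftL, hθ.fderiv_sub]

theorem TwoForm.transgression_sub_mem_exactForms (σ : TwoForm) :
    transgression σ - σ.integral • tau ∈ exactForms (univ : Set Loop) := by
  obtain ⟨θ, hθ, hper⟩ := σ.exists_isPotential
  refine (isPrimitiveMod_comp_chosenLift (P := 0) (contDiff_lineInt hθ.smooth)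
    (fun γ w h ζ => ?_) fun γ _ w _ ζ m n => ?_).mem_exactForms
  · obtain ⟨a, b, hab⟩ := h.exists_prim_eq
    rw [hθ.fderiv_lineInt_liftL h, hab, hper, sub_self, add_zero]
    rfl
  · have hpath : superpose θ (path (w + liftL ζ + (((m : ℝ), (n : ℝ)), 0))) =
        superpose θ (path (w + liftL ζ)) := by
      ext1 s
      exact (congrArg θ (path_add_const _ _ s)).trans (hper _ m n)
    simp only [lineInt, hpath, Prod.snd_add, add_zero]

/-- The 1-form `x dy` on the plane. -/
def xdy : C(Plane, Plane →L[ℝ] ℝ) :=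
  ⟨fun v => v.1 • ContinuousLinearMap.snd ℝ ℝ ℝ, by fun_prop⟩

theorem isPotential_xdy : IsPotential areaForm 0 xdy where
  smooth := contDiff_fst.smul contDiff_const
  fderiv_sub v a b := by
    have hderiv : HasFDerivAt xdy _ v :=
      (hasFDerivAt_fst (𝕜 := ℝ) (p := v)).smul_const (ContinuousLinearMap.snd ℝ ℝ ℝ)
    rw [hderiv.fderiv, areaForm_apply]
    simp
    ring

theorem pairing_const (L : Plane →L[ℝ] ℝ) (u : L2) : pairing (.const _ L) u = L (prim u 1) := by
  rw [pairing_apply]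
  refine (integral_unitInterval_eq fun s => L (u (s : UnitAddCircle))).trans ?_
  exact L.intervalIntegral_comp_comm (intervalIntegrable_of_integrable (integrable_L2 u))

theorem lineInt_xdy_add (w : PathData) (p : Plane) :
    lineInt xdy (w + (p, 0)) = lineInt xdy w + p.1 * (prim w.2 1).2 := by
  have hsuperpose : superpose xdy (path (w + (p, 0))) =
      superpose xdy (path w) + .const _ (p.1 • .snd ℝ ℝ ℝ) := by
    ext1 s
    exact (congrArg xdy (path_add_const w p s)).trans (add_smul _ _ _)
  rw [lineInt, hsuperpose, map_add, add_apply, Prod.snd_add, add_zero, pairing_const]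
  rfl

/-- The end point displacement of a path with given velocity. -/
def displacement : L2 →L[ℝ] Plane :=
  ((ContinuousMap.evalCLM ℝ (1 : unitInterval)).comp path).comp (.inr ℝ Plane L2)

theorem displacement_apply (u : L2) : displacement u = prim u 1 := by
  change path (0, u) 1 = _
  rw [path_one, zero_add]

/-- The area `∫ x dy` swept by a path, corrected so that its derivative at the lift of a loop is
`tau`, without boundary terms. -/
def sweptArea (w : PathData) : ℝ := lineInt xdy w - (displacement w.2).1 * w.1.2

theorem contDiff_sweptArea : ContDiff ℝ ∞ sweptArea :=
  (contDiff_lineInt isPotential_xdy.smooth).sub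
    (((contDiff_fst.comp displacement.contDiff).comp contDiff_snd).mul
      (contDiff_snd.comp contDiff_fst))

theorem fderiv_sweptArea_liftL {γ : Loop} {w : PathData} (h : IsLift γ w) (ζ : LoopVec) :
    fderiv ℝ sweptArea w (liftL ζ) = tau γ ζ := by
  have hlineInt : HasFDerivAt (lineInt xdy) _ w :=
    ((contDiff_lineInt isPotential_xdy.smooth).differentiable (by simp) w).hasFDerivAt
  let D : PathData →L[ℝ] ℝ :=
    (ContinuousLinearMap.fst ℝ ℝ ℝ).comp (displacement.comp (.snd ℝ Plane L2))
  let Y : PathData →L[ℝ] ℝ := (ContinuousLinearMap.snd ℝ ℝ ℝ).comp (.fst ℝ Plane L2)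
  have hderiv : HasFDerivAt sweptArea _ w :=
    hlineInt.sub ((D.hasFDerivAt (x := w)).mul (Y.hasFDerivAt (x := w)))
  have hD : D (liftL ζ) = 0 := by
    change (displacement (liftL ζ).2).1 = 0
    rw [displacement_apply, prim_liftL]
    rfl
  have hDw : D w = (prim w.2 1).1 := congrArg Prod.fst (displacement_apply w.2)
  rw [hderiv.fderiv]
  simp only [sub_apply, add_apply, smul_apply, hD, hDw, isPotential_xdy.fderiv_lineInt_liftL h]
  simp [xdy, Y, tau]
  ring

theorem sweptArea_add (w : PathData) (p : Plane) :
    sweptArea (w + (p, 0)) =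
      sweptArea w + (p.1 * (prim w.2 1).2 - (prim w.2 1).1 * p.2) := by
  simp only [sweptArea, lineInt_xdy_add, displacement_apply, Prod.snd_add, Prod.fst_add, add_zero]
  ring

theorem isPrimitiveMod_tau :
    IsPrimitiveMod 1 (fun γ => sweptArea (chosenLift γ)) tau univ := by
  refine isPrimitiveMod_comp_chosenLift contDiff_sweptArea
    (fun _ _ h ζ => (fderiv_sweptArea_liftL h ζ).symm) fun γ _ w h ζ m n => ?_
  obtain ⟨a, b, hab⟩ := (h.add ζ).exists_prim_eq
  rw [sweptArea_add, hab]
  exact (coe_eq_coe_iff_exists_int _ _).2 ⟨m * b - a * n, by push_cast; rfl⟩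

theorem prim_eq_of_mem_component {a b : ℤ} {γ : Loop} (hγ : γ ∈ component a b)
    {w : PathData} (h : IsLift γ w) : prim w.2 1 = ((a : ℝ), (b : ℝ)) := by
  obtain ⟨hpos, c, hc, hcγ, hcT⟩ := hγ
  have hT : γ.2 ≠ 0 := (show 0 < γ.2 from hpos).ne'
  have hproj : ∀ s ∈ Icc (0 : ℝ) 1, proj (c (γ.2 * s)) = proj (w.1 + prim w.2 s) := fun s hs => by
    rw [hcγ, Loop.curve, mul_div_cancel_left₀ _ hT]
    exact (h.proj_path ⟨s, hs⟩).symm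
  have hproj_zero : proj (c 0) = proj w.1 := by
    simpa using hproj 0 (left_mem_Icc.2 zero_le_one)
  have hproj' : ∀ s ∈ Icc (0 : ℝ) 1, proj (c (γ.2 * s)) = proj (c 0 + prim w.2 s) :=
    fun s hs => by rw [hproj s hs, map_add, map_add, hproj_zero]
  have := continuousOn_prim w.2
  have hfst := eqOn_of_coe_eqOn (f := fun s => (c (γ.2 * s)).1)
    (h := fun s => (c 0 + prim w.2 s).1) (by fun_prop) (by fun_prop) (by simp)
    (fun s hs => congrArg Prod.fst (hproj' s hs)) (right_mem_Icc.2 zero_le_one)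
  have hsnd := eqOn_of_coe_eqOn (f := fun s => (c (γ.2 * s)).2)
    (h := fun s => (c 0 + prim w.2 s).2) (by fun_prop) (by fun_prop) (by simp)
    (fun s hs => congrArg Prod.snd (hproj' s hs)) (right_mem_Icc.2 zero_le_one)
  have hend : c (γ.2 * 1) = c 0 + prim w.2 1 := Prod.ext hfst hsnd
  rw [mul_one, hcT, add_comm] at hend
  exact (add_left_cancel hend).symm

theorem tau_mem_exactForms_component_zero : tau ∈ exactForms (component 0 0) := by
  refine (isPrimitiveMod_comp_chosenLift (P := 0) contDiff_sweptArea
    (fun _ _ h ζ => (fderiv_sweptArea_liftL h ζ).symm) fun γ hγ w h ζ m n => ?_).mem_exactForms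
  have hprim : prim (w + liftL ζ).2 1 = 0 := by
    rw [Prod.snd_add, prim_add _ _ (right_mem_Icc.2 zero_le_one), prim_liftL,
      prim_eq_of_mem_component hγ h]
    simp
  rw [sweptArea_add, hprim]
  simp

end Lifts

/-! ### The action 1-form -/

section Action

variable (g : TorusMetric) (σ : TwoForm) (k : ℝ)

/-- The metric, lifted to the plane. -/
def TorusMetric.lift : C(Plane, Plane →L[ℝ] Plane →L[ℝ] ℝ) :=
  ⟨fun v => g.toFun (proj v), g.smooth.continuous.comp continuous_proj⟩

/-- Twice the kinetic energy `∫₀¹ |w'(s)|² ds` of a path in the plane, for the lifted metric. -/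
def TorusMetric.energy (w : PathData) : ℝ :=
  pairing₂ (superpose g.lift (path w)) w.2 w.2

theorem TorusMetric.contDiff_energy : ContDiff ℝ ∞ g.energy := by
  have hlift : ContDiff ℝ ∞ g.lift :=
    (hasTranslationCharts_proj.contMDiff_iff proj_surjective).1 g.smooth
  have hpath : ContDiff ℝ ∞ fun w : PathData => superpose g.lift (path w) :=
    (contDiff_superpose g.lift hlift).comp path.contDiff
  exact ((pairing₂.contDiff.comp hpath).clm_apply contDiff_snd).clm_apply contDiff_snd

theorem integrable_kinetic (γ : Loop) :
    Integrable (fun s => g.toFun (Loop.pt γ s) (Loop.vel γ s) (Loop.vel γ s)) volume := by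
  obtain ⟨C, hC⟩ := isCompact_univ.exists_bound_of_continuousOn
    (f := g.toFun) g.smooth.continuous.continuousOn
  have hsq : Integrable (fun s => ‖γ.1.1.2 s‖ ^ 2) volume := by
    simpa using (Lp.memLp γ.1.1.2).integrable_norm_pow (by norm_num)
  refine (hsq.const_mul C).mono' ?_ (.of_forall fun s => ?_)
  · have hmetric : Continuous fun s => g.toFun (Loop.pt γ s) :=
      g.smooth.continuous.comp γ.1.1.1.continuous
    have hvel := (integrable_L2 γ.1.1.2).aestronglyMeasurable
    exact (ContinuousLinearMap.id ℝ (Plane →L[ℝ] ℝ)).aestronglyMeasurable_comp₂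
      ((ContinuousLinearMap.id ℝ (Plane →L[ℝ] Plane →L[ℝ] ℝ)).aestronglyMeasurable_comp₂
        hmetric.aestronglyMeasurable hvel) hvel
  · calc ‖g.toFun (Loop.pt γ s) (Loop.vel γ s) (Loop.vel γ s)‖
        ≤ ‖g.toFun (Loop.pt γ s)‖ * ‖Loop.vel γ s‖ * ‖Loop.vel γ s‖ :=
          ContinuousLinearMap.le_opNorm₂ _ _ _
      _ ≤ C * ‖Loop.vel γ s‖ * ‖Loop.vel γ s‖ := by gcongr; exact hC _ (mem_univ _)
      _ = C * ‖γ.1.1.2 s‖ ^ 2 := by rw [mul_assoc, sq]; rfl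

theorem action_eq {γ : Loop} {w : PathData} (h : IsLift γ w) :
    action g k γ = γ.2 * (1 / (2 * γ.2 ^ 2) * g.energy w + k) := by
  have henergy : ∫ s, g.toFun (Loop.pt γ s) (Loop.vel γ s) (Loop.vel γ s) = g.energy w := by
    rw [TorusMetric.energy, pairing₂_apply, integral_circle_eq]
    simp only [h.vel_eq, ← h.proj_path]
    rfl
  rw [action, integral_add ((integrable_kinetic g γ).const_mul _) (integrable_const k),
    integral_const_mul, integral_const, henergy]
  simp

theorem contMDiffAt_action {γ : Loop} (hγ : γ ∈ freeLoops) :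
    ContMDiffAt 𝓘(ℝ, LoopVec) 𝓘(ℝ, ℝ) ∞ (action g k) γ := by
  obtain ⟨w, h⟩ := exists_isLift γ
  have haction : (fun ζ : LoopVec => action g k (γ + freeExp ζ)) = fun ζ => (γ.2 + ζ.2) *
      (1 / (2 * (γ.2 + ζ.2) ^ 2) * g.energy (w + liftL ζ) + k) :=
    funext fun ζ => action_eq g k (h.add ζ)
  rw [hasTranslationCharts_freeExp.contMDiffAt_iff_zero, haction]
  have hpos : 0 < γ.2 := hγ
  have henergy : ContDiffAt ℝ ∞ (fun ζ : LoopVec => g.energy (w + liftL ζ)) 0 :=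
    (g.contDiff_energy.comp (contDiff_const.add liftL.contDiff)).contDiffAt
  have hperiod : ContDiffAt ℝ ∞ (fun ζ : LoopVec => γ.2 + ζ.2) 0 := by fun_prop
  have hfactor : ContDiffAt ℝ ∞ (fun ζ : LoopVec => 1 / (2 * (γ.2 + ζ.2) ^ 2)) 0 :=
    contDiffAt_const.div (contDiffAt_const.mul (hperiod.pow 2)) (by
      simp only [Prod.snd_zero, add_zero]; positivity)
  exact hperiod.mul ((hfactor.mul henergy).add contDiffAt_const)

theorem eta_sub_mem_exactForms : eta g σ k - σ.integral • tau ∈ exactForms freeLoops := by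
  obtain ⟨f, hf⟩ := σ.transgression_sub_mem_exactForms
  rw [eta, add_sub_assoc]
  exact add_mem ⟨action g k, fun γ hγ => ⟨contMDiffAt_action g k hγ, rfl⟩⟩
    ⟨f, fun γ _ => hf γ (mem_univ γ)⟩

theorem isOpen_freeLoops : IsOpen freeLoops := isOpen_lt continuous_const continuous_snd

theorem exists_isPrimitiveMod_eta : ∃ Q, IsPrimitiveMod σ.integral Q (eta g σ k) freeLoops := by
  have htau := (isPrimitiveMod_tau.mono (subset_univ freeLoops)).const_smul σ.integral
  rw [mul_one] at htau
  exact htau.exists_of_sub_mem_exactForms isOpen_freeLoops (eta_sub_mem_exactForms g σ k)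

theorem eta_mem_closedForms : eta g σ k ∈ closedForms freeLoops :=
  (exists_isPrimitiveMod_eta g σ k).elim fun _ => hasTranslationCharts_freeExp.mem_closedForms

theorem discreteTopology_periods_eta {U : Set Loop} (hU : U ⊆ freeLoops) :
    DiscreteTopology (periods (eta g σ k) U) := by
  obtain ⟨Q, hQ⟩ := exists_isPrimitiveMod_eta g σ k
  exact .of_subset (inferInstanceAs (DiscreteTopology (AddSubgroup.zmultiples σ.integral)))
    (hQ.mono hU).periods_le_zmultiples

theorem tau_mem_closedForms (U : Set Loop) : tau ∈ closedForms U :=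
  hasTranslationCharts_freeExp.mem_closedForms (isPrimitiveMod_tau.mono (subset_univ U))

end Action

/-! ### Straight loops -/

section Straight

theorem constLoop_mem (v : Plane) : (ContinuousMap.const UnitAddCircle v, (0 : L2)) ∈ H1 := by
  intro s hs
  simp [prim_zero hs]

/-- The constant vector fields along loops, with no variation of the period: the derivative of
the torus of straight loops. -/
def constL : Plane →L[ℝ] LoopVec :=
  (((ContinuousLinearMap.const ℝ UnitAddCircle).prod (0 : Plane →L[ℝ] L2)).codRestrict H1
    constLoop_mem).prod 0

theorem straight_add (a b : ℤ) (T : ℝ) (q : Torus) (v : Plane) :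
    straight a b T (q + proj v) = straight a b T q + freeExp (constL v) := by
  refine Prod.ext (Subtype.ext (Prod.ext ?_ ?_)) ?_
  · ext1 s
    exact add_right_comm _ _ _
  · exact (add_zero (Lp.const 2 (volume : Measure UnitAddCircle) ((a : ℝ), (b : ℝ)) : L2)).symm
  · exact (add_zero T).symm

theorem zsmul_coe_eq_coe_smul (n : ℤ) (s : ℝ) :
    n • (s : UnitAddCircle) = ((s • (n : ℝ) : ℝ) : UnitAddCircle) := by
  rw [← AddCircle.coe_zsmul, zsmul_eq_mul, smul_eq_mul, mul_comm]

theorem straight_mem_component (a b : ℤ) {T : ℝ} (hT : 0 < T) (q : Torus) :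
    straight a b T q ∈ component a b := by
  obtain ⟨p, rfl⟩ := proj_surjective q
  refine ⟨hT, fun t => p + (t / T) • ((a : ℝ), (b : ℝ)), by fun_prop, fun t => ?_, ?_⟩
  · exact (map_add proj _ _).trans <| congrArg (proj p + ·) <|
      Prod.ext (zsmul_coe_eq_coe_smul a _).symm (zsmul_coe_eq_coe_smul b _).symm
  · change p + (T / T) • ((a : ℝ), (b : ℝ)) = ((a : ℝ), (b : ℝ)) + (p + (0 / T) • _)
    rw [div_self hT.ne', one_smul, zero_div, zero_smul, add_zero, add_comm]

theorem contMDiff_straight (a b : ℤ) (T : ℝ) :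
    ContMDiff 𝓘(ℝ, Plane) 𝓘(ℝ, LoopVec) ∞ (straight a b T) := fun q =>
  (hasTranslationCharts_proj.hasMFDerivAt_of_linear hasTranslationCharts_freeExp constL
    (straight_add a b T q)).1

theorem pullback_straight (a b : ℤ) (T : ℝ) (α : OneForm LoopVec Loop) (q : Torus) :
    pullback (straight a b T) α q = (α (straight a b T q)).comp constL :=
  congrArg (fun L : Plane →L[ℝ] LoopVec => (α (straight a b T q)).comp L)
    (hasTranslationCharts_proj.hasMFDerivAt_of_linear hasTranslationCharts_freeExp constL
      (straight_add a b T q)).2.mfderiv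

theorem pullback_straight_tau (a b : ℤ) (T : ℝ) :
    pullback (straight a b T) tau = (b : ℝ) • dq1 - (a : ℝ) • dq2 := by
  funext q
  rw [pullback_straight]
  refine ContinuousLinearMap.ext fun v => ?_
  have hconst : (fun s => areaForm.toFun (Loop.pt (straight a b T q) s)
      (LoopVec.field (constL v) s) (Loop.vel (straight a b T q) s)) =ᵐ[volume]
        fun _ => (b : ℝ) * v.1 - (a : ℝ) * v.2 := by
    filter_upwards [Lp.coeFn_const 2 (volume : Measure UnitAddCircle) ((a : ℝ), (b : ℝ))] with s hs
    have hvel : Loop.vel (straight a b T q) s = ((a : ℝ), (b : ℝ)) := hs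
    have hfield : LoopVec.field (constL v) s = v := rfl
    rw [hvel, hfield, areaForm_apply]
    ring
  exact (integral_congr_ae hconst).trans (by simp [dq1, dq2])

theorem pullback_straight_eta_sub_mem_exactForms (g : TorusMetric) (σ : TwoForm) (k : ℝ)
    (a b : ℤ) {T : ℝ} (hT : 0 < T) :
    pullback (E := Plane) (straight a b T) (eta g σ k) -
      σ.integral • ((b : ℝ) • dq1 - (a : ℝ) • dq2) ∈ exactForms (univ : Set Torus) := by
  have hpull : pullback (E := Plane) (straight a b T) (eta g σ k - σ.integral • tau) =
      pullback (straight a b T) (eta g σ k) - σ.integral • pullback (straight a b T) tau := by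
    funext q
    simp only [pullback_straight, Pi.sub_apply, Pi.smul_apply, ContinuousLinearMap.sub_comp,
      ContinuousLinearMap.smul_comp]
  have huniv : straight a b T ⁻¹' freeLoops = univ :=
    eq_univ_of_forall fun q => (straight_mem_component a b hT q).1
  rw [← pullback_straight_tau a b T, ← hpull, ← huniv]
  exact pullback_mem_exactForms (contMDiff_straight a b T) (eta_sub_mem_exactForms g σ k)

theorem const_mem_closedForms {E X : Type*} [NormedAddCommGroup E] [NormedSpace ℝ E]
    [TopologicalSpace X] [ChartedSpace E X] (L : E →L[ℝ] ℝ) (U : Set X) :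
    (fun _ => L : OneForm E X) ∈ closedForms U := fun x _ => by
  refine ⟨contMDiffAt_const, fun v w => ?_⟩
  have hzero : formDer (fun _ => L : OneForm E X) x = 0 := mfderiv_const
  rw [hzero]
  rfl

theorem smul_dq1_sub_smul_dq2_eq_const (a b : ℝ) :
    a • dq1 - b • dq2 =
      fun _ => a • ContinuousLinearMap.fst ℝ ℝ ℝ - b • ContinuousLinearMap.snd ℝ ℝ ℝ := rfl

theorem smul_dq1_sub_smul_dq2_mem_closedForms (a b : ℝ) (U : Set Torus) :
    a • dq1 - b • dq2 ∈ closedForms U := by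
  rw [smul_dq1_sub_smul_dq2_eq_const]
  exact const_mem_closedForms _ U

theorem pullback_straight_eta_mem_closedForms (g : TorusMetric) (σ : TwoForm) (k : ℝ) (a b : ℤ)
    {T : ℝ} (hT : 0 < T) :
    pullback (E := Plane) (straight a b T) (eta g σ k) ∈ closedForms (univ : Set Torus) := by
  have hsub := hasTranslationCharts_proj.exactForms_le_closedForms isOpen_univ
    (pullback_straight_eta_sub_mem_exactForms g σ k a b hT)
  rwa [Submodule.sub_mem_iff_left] at hsub
  exact Submodule.smul_mem _ _ (smul_dq1_sub_smul_dq2_mem_closedForms _ _ univ)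

theorem eq_zero_of_const_mem_exactForms {E X : Type*} [NormedAddCommGroup E] [NormedSpace ℝ E]
    [TopologicalSpace X] [AddCommGroup X] [IsTopologicalAddGroup X] [ChartedSpace E X]
    [CompactSpace X] {p : E →+ X}
    (hp : HasTranslationCharts p) {L : E →L[ℝ] ℝ}
    (hL : (fun _ => L : OneForm E X) ∈ exactForms univ) : L = 0 := by
  obtain ⟨f, hf⟩ := hL
  have hcont : Continuous f := continuous_iff_continuousAt.2 fun x => (hf x trivial).1.continuousAt
  obtain ⟨x, -, hmax⟩ := isCompact_univ.exists_isMaxOn ⟨(0 : X), trivial⟩ hcont.continuousOn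
  have hlocal : IsLocalMax (fun e => f (x + p e)) 0 :=
    .of_forall fun e => by simpa using hmax (mem_univ (x + p e))
  have hdiff : DifferentiableAt ℝ (fun e => f (x + p e)) 0 :=
    (hp.contMDiffAt_iff_zero.1 (hf x trivial).1).differentiableAt (by simp)
  have hderiv := hp.mfderiv_eq hdiff
  rw [hlocal.fderiv_eq_zero, map_zero, add_zero] at hderiv
  exact (hf x trivial).2.trans hderiv

theorem tau_mem_exactForms_component_iff (a b : ℤ) :
    tau ∈ exactForms (component a b) ↔ (a, b) = (0, 0) := by
  refine ⟨fun h => ?_, fun h => ?_⟩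
  · have hpull := pullback_mem_exactForms (contMDiff_straight a b 1) h
    have huniv : straight a b 1 ⁻¹' component a b = univ :=
      eq_univ_of_forall (straight_mem_component a b one_pos)
    rw [pullback_straight_tau, huniv, smul_dq1_sub_smul_dq2_eq_const] at hpull
    have hzero := eq_zero_of_const_mem_exactForms hasTranslationCharts_proj hpull
    have ha := DFunLike.congr_fun hzero (0, 1)
    have hb := DFunLike.congr_fun hzero (1, 0)
    simp at ha hb
    simp [ha, hb]
  · obtain ⟨rfl, rfl⟩ := Prod.mk.inj h
    exact tau_mem_exactForms_component_zero

theorem interiorProduct_areaForm (v : Plane) :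
    interiorProduct v areaForm = -(v.2 • dq1 - v.1 • dq2) := by
  refine funext fun q => ContinuousLinearMap.ext fun w => ?_
  change areaForm.toFun q v w = -(v.2 * w.1 - v.1 * w.2)
  rw [areaForm_apply]
  ring

end Straight

/-! ### Loops avoiding a point -/

section Avoiding

/-- The loops of positive period with image in `V`. -/
def loopsIn (V : Set Torus) : Set Loop := {γ | γ ∈ freeLoops ∧ ∀ s, Loop.pt γ s ∈ V}

theorem forall_curve_iff {γ : Loop} (hγ : γ ∈ freeLoops) (P : Torus → Prop) :
    (∀ t, P (Loop.curve γ t)) ↔ ∀ s, P (Loop.pt γ s) := by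
  have hT : γ.2 ≠ 0 := (show 0 < γ.2 from hγ).ne'
  refine ⟨fun h s => ?_, fun h t => h _⟩
  obtain ⟨r, rfl⟩ := QuotientAddGroup.mk_surjective s
  have hr := h (γ.2 * r)
  rwa [Loop.curve, mul_div_cancel_left₀ _ hT] at hr

theorem avoiding_eq_loopsIn (q : Torus) : avoiding q = loopsIn {q}ᶜ :=
  ext fun _ => and_congr_right fun hγ => forall_curve_iff hγ (· ≠ q)

theorem isOpen_loopsIn {V : Set Torus} (hV : IsOpen V) : IsOpen (loopsIn V) := by
  have hpt : Continuous fun γ : Loop => γ.1.1.1 := by fun_prop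
  have hmaps := (ContinuousMap.isOpen_setOfPred_mapsTo (X := UnitAddCircle) isCompact_univ
    hV).preimage hpt
  simpa only [MapsTo, mem_univ, true_imp_iff] using! isOpen_freeLoops.inter hmaps

theorem isOpen_avoiding (q : Torus) : IsOpen (avoiding q) :=
  avoiding_eq_loopsIn q ▸ isOpen_loopsIn isOpen_compl_singleton

theorem mem_avoiding_of_isRotatedIterate {γ β : Loop} {q : Torus} (hγ : γ ∈ avoiding q) {n : ℕ}
    (hn : 0 < n) {ψ : UnitAddCircle} (h : IsRotatedIterate γ n ψ β) : β ∈ avoiding q := by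
  rw [avoiding_eq_loopsIn] at hγ ⊢
  refine ⟨?_, fun s => h.2 s ▸ hγ.2 _⟩
  have hpos : 0 < γ.2 := hγ.1
  change 0 < β.2
  rw [h.1]
  positivity

theorem dimH_range_le_one_of_dist_le {X : Type*} {Y : Type*} [MetricSpace Y] {f : X → Y}
    {V : X → ℝ} (h : ∀ s t, dist (f s) (f t) ≤ dist (V s) (V t)) : dimH (range f) ≤ 1 := by
  obtain _ | _ := isEmpty_or_nonempty X
  · simp [range_eq_empty]
  choose! ψ hψ using fun (y : ℝ) (hy : y ∈ range V) => hy
  have hlip : LipschitzOnWith 1 (f ∘ ψ) (range V) := by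
    refine LipschitzOnWith.of_dist_le_mul fun x hx y hy => ?_
    simpa [hψ x hx, hψ y hy] using h (ψ x) (ψ y)
  have himg : range f ⊆ f ∘ ψ '' range V := by
    rintro _ ⟨s, rfl⟩
    refine ⟨V s, mem_range_self s, dist_le_zero.1 ((h _ s).trans_eq ?_)⟩
    rw [hψ (V s) (mem_range_self s), dist_self]
  calc dimH (range f) ≤ dimH (f ∘ ψ '' range V) := dimH_mono himg
    _ ≤ dimH (range V) := hlip.dimH_image_le
    _ ≤ dimH (univ : Set ℝ) := dimH_mono (subset_univ _)
    _ = 1 := Real.dimH_univ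

theorem dist_path_le (w : PathData) (s t : unitInterval) :
    dist (path w s) (path w t) ≤ dist (∫ r in (0 : ℝ)..s, ‖w.2 (r : UnitAddCircle)‖)
      (∫ r in (0 : ℝ)..t, ‖w.2 (r : UnitAddCircle)‖) := by
  have hint := fun s : unitInterval => intervalIntegrable_L2 w.2 s.2
  rw [dist_eq_norm, dist_eq_norm, path_apply, path_apply, add_sub_add_left_eq_sub, prim, prim,
    intervalIntegral.integral_interval_sub_left (hint s) (hint t),
    intervalIntegral.integral_interval_sub_left (hint s).norm (hint t).norm]
  exact intervalIntegral.norm_integral_le_abs_integral_norm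

theorem exists_unitInterval_coe (s : UnitAddCircle) :
    ∃ r : unitInterval, ((r : ℝ) : UnitAddCircle) = s := by
  obtain ⟨x, rfl⟩ := QuotientAddGroup.mk_surjective s
  refine ⟨⟨Int.fract x, Int.fract_nonneg x, (Int.fract_lt_one x).le⟩, ?_⟩
  exact (coe_eq_coe_iff_exists_int _ _).2 ⟨-⌊x⌋, by simp [Int.fract, sub_eq_add_neg]⟩

/- The lifts of the loop sweep out a countable union of sets of dimension at most one. -/
theorem exists_forall_pt_ne (γ : Loop) : ∃ q, ∀ s, Loop.pt γ s ≠ q := by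
  obtain ⟨w, hw⟩ := exists_isLift γ
  let S : Set Plane := ⋃ z : ℤ × ℤ, (· + ((z.1 : ℝ), (z.2 : ℝ))) '' range (path w)
  have hS : dimH S ≤ 1 := by
    rw [dimH_iUnion]
    exact iSup_le fun z => ((IsometryEquiv.addRight (((z.1 : ℝ), (z.2 : ℝ)) : Plane)).isometry
      |>.dimH_image _).trans_le (dimH_range_le_one_of_dist_le (dist_path_le w))
  obtain ⟨p, hp⟩ := (dense_compl_of_dimH_lt_finrank (s := S) (hS.trans_lt (by simp))).nonempty
  refine ⟨proj p, fun s hs => hp ?_⟩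
  obtain ⟨r, rfl⟩ := exists_unitInterval_coe s
  rw [← hw.proj_path] at hs
  obtain ⟨m, n, hmn⟩ := (proj_eq_proj_iff _ _).1 hs.symm
  exact mem_iUnion.2 ⟨(m, n), path w r, mem_range_self r, hmn.symm⟩

/-- The product of a smooth function and a 2-form. -/
def TwoForm.mulFun (σ : TwoForm) (f : Torus → ℝ) (hf : ContMDiff 𝓘(ℝ, Plane) 𝓘(ℝ, ℝ) ∞ f) :
    TwoForm where
  toFun q := f q • σ.toFun q
  smooth := hf.smul σ.smooth
  alt q v := by simp [σ.alt]

theorem exists_twoForm_integral_eq_zero {q : Torus} {K : Set Torus} (hK : K ∈ 𝓝 q) :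
    ∃ σ : TwoForm, σ.integral = 0 ∧ ∀ x ∉ K, σ.toFun x = areaForm.toFun x := by
  obtain ⟨f, -, hf⟩ := (SmoothBumpFunction.nhds_basis_tsupport (I := 𝓘(ℝ, Plane)) q).mem_iff.1 hK
  have hsmooth : ContMDiff 𝓘(ℝ, Plane) 𝓘(ℝ, ℝ) ∞ f := f.contMDiff
  have hpos : 0 < ∫ x, f x :=
    f.continuous.integral_pos_of_hasCompactSupport_nonneg_nonzero f.hasCompactSupport
      (fun _ => f.nonneg) (x := q) (by simp)
  have hint : Integrable f := f.continuous.integrable_of_hasCompactSupport f.hasCompactSupport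
  refine ⟨areaForm.mulFun (fun x => 1 - (∫ x, f x)⁻¹ * f x)
    (contMDiff_const.sub (contMDiff_const.mul hsmooth)), ?_, fun x hx => ?_⟩
  · have happly : ∀ x, (1 - (∫ x, f x)⁻¹ * f x) * areaForm.toFun x (1, 0) (0, 1) =
        1 - (∫ x, f x)⁻¹ * f x := fun x => by simp [areaForm_apply]
    refine (integral_congr_ae (.of_forall happly)).trans ?_
    rw [integral_sub (integrable_const 1) (hint.const_mul _), integral_const_mul,
      inv_mul_cancel₀ hpos.ne']
    simp
  · have hzero : f x = 0 := image_eq_zero_of_notMem_tsupport fun h => hx (hf h)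
    simp [TwoForm.mulFun, hzero]

theorem tau_mem_exactForms_loopsIn_compl {q : Torus} {K : Set Torus} (hK : K ∈ 𝓝 q) :
    tau ∈ exactForms (loopsIn Kᶜ) := by
  obtain ⟨σ, hσ, heq⟩ := exists_twoForm_integral_eq_zero hK
  obtain ⟨f, hf⟩ := σ.transgression_sub_mem_exactForms
  refine ⟨f, fun γ hγ => ⟨(hf γ trivial).1, ?_⟩⟩
  rw [← (hf γ trivial).2, hσ, zero_smul, sub_zero]
  refine ContinuousLinearMap.ext fun ζ => integral_congr_ae (.of_forall fun s => ?_)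
  simp only [heq _ (hγ.2 s)]

theorem loopsIn_mono {V W : Set Torus} (h : V ⊆ W) : loopsIn V ⊆ loopsIn W :=
  fun _ hγ => ⟨hγ.1, fun s => h (hγ.2 s)⟩

theorem avoiding_eq_iUnion (q : Torus) :
    avoiding q = ⋃ r : {r : ℝ // 0 < r}, loopsIn (Metric.closedBall q r)ᶜ := by
  rw [avoiding_eq_loopsIn]
  refine Subset.antisymm (fun γ hγ => ?_) (iUnion_subset fun r γ hγ => ⟨hγ.1, fun s hs => ?_⟩)
  · have hrange : (range (Loop.pt γ))ᶜ ∈ 𝓝 q :=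
      (isCompact_range γ.1.1.1.continuous).isClosed.isOpen_compl.mem_nhds
        fun ⟨s, hs⟩ => hγ.2 s hs
    obtain ⟨r, hr, hball⟩ := Metric.nhds_basis_closedBall.mem_iff.1 hrange
    exact mem_iUnion.2 ⟨⟨r, hr⟩, hγ.1, fun s hs => hball hs (mem_range_self s)⟩
  · exact hγ.2 s (mem_singleton_iff.1 hs ▸ Metric.mem_closedBall_self r.2.le)

theorem tau_mem_exactForms_avoiding (q : Torus) : tau ∈ exactForms (avoiding q) := by
  rw [avoiding_eq_iUnion]
  refine hasTranslationCharts_freeExp.iUnion_mem_exactForms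
    (fun r => isOpen_loopsIn Metric.isClosed_closedBall.isOpen_compl) (fun r s => ?_)
    fun r => tau_mem_exactForms_loopsIn_compl (Metric.closedBall_mem_nhds q r.2)
  exact ⟨⟨min r s, lt_min r.2 s.2⟩,
    loopsIn_mono (compl_subset_compl.2 (Metric.closedBall_subset_closedBall (min_le_left _ _))),
    loopsIn_mono (compl_subset_compl.2 (Metric.closedBall_subset_closedBall (min_le_right _ _)))⟩

end Avoiding

end

end MagneticTorus

theorem lemma5p3 :
    -- `τ` is a closed 1-form on the free loop space `ℳ`
    tau ∈ closedForms freeLoops ∧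
    -- (i) the class of `τ` on the components `ℳ(a, b)`
    (∀ a b : ℤ,
      (∀ T : ℝ, 0 < T →
        ContMDiff 𝓘(ℝ, Plane) 𝓘(ℝ, LoopVec) ∞ (straight a b T) ∧
        (∀ q, straight a b T q ∈ component a b) ∧
        ∃ (h₁ : pullback (straight a b T) tau ∈ closedForms (univ : Set Torus))
          (h₂ : interiorProduct ((a : ℝ), (b : ℝ)) areaForm ∈ closedForms (univ : Set Torus))
          (h₃ : (b : ℝ) • dq1 - (a : ℝ) • dq2 ∈ closedForms (univ : Set Torus)),
          cohClass univ (pullback (straight a b T) tau) h₁ =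
              -cohClass univ (interiorProduct ((a : ℝ), (b : ℝ)) areaForm) h₂ ∧
          cohClass univ (pullback (straight a b T) tau) h₁ =
              cohClass univ ((b : ℝ) • dq1 - (a : ℝ) • dq2) h₃) ∧
      ∃ h : tau ∈ closedForms (component a b),
        cohClass (component a b) tau h = 0 ↔ (a, b) = (0, 0)) ∧
    -- (ii) the class of `τ` is trivial on the neighbourhoods `𝒱^γ` of loops avoiding a point `q`
    -- outside the image of `γ`
    (∀ γ ∈ freeLoops, (∃ q, ∀ t, Loop.curve γ t ≠ q) ∧
      ∀ q, (∀ t, Loop.curve γ t ≠ q) →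
        IsOpen (avoiding q) ∧
        (∀ (n : ℕ) (ψ : UnitAddCircle) (β : Loop), 0 < n → IsRotatedIterate γ n ψ β →
          β ∈ avoiding q) ∧
        ∃ h : tau ∈ closedForms (avoiding q), cohClass (avoiding q) tau h = 0) ∧
    -- the action 1-form: its class on `ℳ(a, b)` and its periods
    (∀ (g : TorusMetric) (σ : TwoForm) (k : ℝ), 0 < k →
      eta g σ k ∈ closedForms freeLoops ∧
      ∀ a b : ℤ,
        (∀ T : ℝ, 0 < T →
          ∃ (h₁ : pullback (straight a b T) (eta g σ k) ∈ closedForms (univ : Set Torus))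
            (h₂ : (b : ℝ) • dq1 - (a : ℝ) • dq2 ∈ closedForms (univ : Set Torus)),
            cohClass univ (pullback (straight a b T) (eta g σ k)) h₁ =
              σ.integral • cohClass univ ((b : ℝ) • dq1 - (a : ℝ) • dq2) h₂) ∧
        DiscreteTopology (periods (eta g σ k) (component a b))) := by
  have hform := fun a b : ℝ => smul_dq1_sub_smul_dq2_mem_closedForms a b univ
  refine ⟨tau_mem_closedForms _, fun a b => ⟨fun T hT => ?_, tau_mem_closedForms _, ?_⟩,
    fun γ hγ => ⟨?_, fun q hq => ⟨isOpen_avoiding q, fun n ψ β hn =>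
      mem_avoiding_of_isRotatedIterate ⟨hγ, hq⟩ hn, tau_mem_closedForms _, ?_⟩⟩,
    fun g σ k _ => ⟨eta_mem_closedForms g σ k, fun a b => ⟨fun T hT => ?_,
      discreteTopology_periods_eta g σ k fun γ hγ => hγ.1⟩⟩⟩
  · have hpull := pullback_straight_tau a b T
    have hinterior := interiorProduct_areaForm (a, b)
    have h₂ : interiorProduct ((a : ℝ), (b : ℝ)) areaForm ∈ closedForms univ :=
      hinterior ▸ neg_mem (hform b a)
    refine ⟨contMDiff_straight a b T, straight_mem_component a b hT, hpull ▸ hform b a, h₂,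
      hform b a, (cohClass_eq_iff _ (neg_mem h₂)).2 ?_, (cohClass_eq_iff _ _).2 ?_⟩
    · rw [hpull, hinterior, neg_neg, sub_self]
      exact zero_mem _
    · rw [hpull, sub_self]
      exact zero_mem _
  · exact (cohClass_eq_zero_iff _).trans (tau_mem_exactForms_component_iff a b)
  · exact (exists_forall_pt_ne γ).imp fun q => (forall_curve_iff hγ (· ≠ q)).2
  · exact (cohClass_eq_zero_iff _).2 (tau_mem_exactForms_avoiding q)
  · exact ⟨pullback_straight_eta_mem_closedForms g σ k a b hT, hform b a,
      (cohClass_eq_iff _ (Submodule.smul_mem _ σ.integral (hform b a))).2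
        (pullback_straight_eta_sub_mem_exactForms g σ k a b hT)⟩
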